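/- Let $a>0$, $\mathbf v_1=a(\frac{\sqrt3}{2},\frac12)$, $\mathbf v_2=a(\frac{\sqrt3}{2},-\frac12)$, $\Lambda=\mathbb Z\mathbf v_1\oplus\mathbb Z\mathbf v_2$, $\Gamma=\mathbb R^2/\Lambda$, $\mathbf x_0=\frac23(\mathbf v_1+\mathbf v_2)$. Let $\mathbf k_1=\frac{4\pi}{a\sqrt3}(\frac12,\frac{\sqrt3}2)$, $\mathbf k_2=\frac{4\pi}{a\sqrt3}(\frac12,-\frac{\sqrt3}2)$ be the dual basis ($\mathbf k_i\cdot\mathbf v_j=2\pi\delta_{ij}$), $\xi_{\mathbf m}=m_1\mathbf k_1+m_2\mathbf k_2$ for $\mathbf m\in\mathbb Z^2$, and let $\mathbf K=\frac23\mathbf k_1+\frac13\mathbf k_2$ be the Dirac point. For $\mathbf k\in\mathbb R^2$ let $-\Delta(\mathbf k)$ be the Laplacian in $L^2_{\mathbf k}(\Gamma)=\{f: f(\mathbf x+\mathbf v_j)=e^{i\mathbf k\cdot\mathbf v_j}f(\mathbf x),\ j=1,2\}$ with domain $H^2_{\mathbf k}(\Gamma)$. For $\lambda\notin\sigma(-\Delta(\mathbf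 k))$ put $$g_\lambda(\mathbf x,\mathbf k)=\frac1{\mathrm{area}(\Gamma)}\lim_{r\to\infty}\sum_{|\xi_{\mathbf m}+\mathbf k|\le r}\frac{e^{i(\xi_{\mathbf m}+\mathbf k)\cdot\mathbf x}}{|\xi_{\mathbf m}+\mathbf k|^2-\lambda}\quad(\mathbf x\notin\Lambda),$$ $$g_\lambda(\mathbf x,\mathbf k)=\lim_{r\to\infty}\Big[\frac1{\mathrm{area}(\Gamma)}\sum_{|\xi_{\mathbf m}+\mathbf k|\le r}\frac1{|\xi_{\mathbf m}+\mathbf k|^2-\lambda}-\frac{\ln r}{2\pi}\Big]\quad(\mathbf x\in\Lambda).$$ For $\alpha\in\mathbb R$ and a finite set $Y=\{\mathbf y_1,\dots,\mathbf y_N\}\subset\Gamma$, the point scatterer operator $-\Delta_{\alpha,Y}(\mathbf k)$ in $L^2_{\mathbf k}(\Gamma)$, with the same strength $\alpha$ at every site of $Y$, is the operator with resolvent $$(-\Delta_{\alpha,Y}(\mathbf k)-\lambda)^{-1}f=(-\Delta(\mathbf k)-\lambda)^{-1}f+\sum_{j,j'}\big[\Gamma_{\alpha,Y}(\lambda,\mathbf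 k)^{-1}\big]_{jj'}\,\big(g_{\bar\lambda}(\cdot-\mathbf y_j,\mathbf k),f\big)\,g_\lambda(\cdot-\mathbf y_{j'},\mathbf k)$$ for all $\lambda\notin\sigma(-\Delta(\mathbf k))$ for which the matrix $[\Gamma_{\alpha,Y}(\lambda,\mathbf k)]_{jj'}=\alpha\delta_{jj'}-g_\lambda(\mathbf y_{j'}-\mathbf y_j,\mathbf k)$ is invertible, where $(f,g)=\int_\Gamma\overline f g$. **Proposition.** Let $\alpha\in\mathbb R$. At the Dirac point $\mathbf K$, the perturbed eigenvalues of the honeycomb operator coincide with those of the triangular lattice operator, $$\sigma(-\Delta_{\alpha,\{\mathbf 0,\mathbf x_0\}}(\mathbf K))\setminus\sigma(-\Delta(\mathbf K))=\sigma(-\Delta_{\alpha,\{\mathbf 0\}}(\mathbf K))\setminus\sigma(-\Delta(\mathbf K)),$$ and each $\lambda'\in\sigma(-\Delta_{\alpha,\{\mathbf 0,\mathbf x_0\}}(\mathbf K))\setminus\sigma(-\Delta(\mathbf K))$ is an eigenvalue of $-\Delta_{\alpha,\{\mathbf 0,\mathbf x_0\}}(\mathbf K)$ of multiplicity $2$.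 Moreover, for every $\lambda\notin\sigma(-\Delta(\mathbf K))$ the limit defining $g_\lambda(\mathbf x_0,\mathbf K)$ exists and $g_\lambda(\mathbf x_0,\mathbf K)=0$. -/

import Mathlib

open MeasureTheory Filter Topology ComplexConjugate

noncomputable section

namespace PointScatterer

/-! ### Spectrum of an unbounded operator -/

section Spectrum

variable {H : Type*} [NormedAddCommGroup H] [InnerProductSpace ℂ H]

/-- `z` is in the resolvent set of the unbounded operator `T`: there is a bounded, everywhere
defined, two-sided inverse of `T - z`. -/
def InResolventSet (T : H →ₗ.[ℂ] H) (z : ℂ) : Prop :=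
  ∃ S : H →L[ℂ] H,
    (∀ f : H, ∃ hf : S f ∈ T.domain, T ⟨S f, hf⟩ - z • S f = f) ∧
    ∀ ψ : T.domain, S (T ψ - z • (ψ : H)) = ψ

/-- The spectrum `σ(T)`. -/
def opSpectrum (T : H →ₗ.[ℂ] H) : Set ℂ := {z | ¬ InResolventSet T z}

/-- The eigenspace `ker (T - z)`: the `ψ` in the domain of `T` with `T ψ = z ψ`. -/
def eigenspace (T : H →ₗ.[ℂ] H) (z : ℂ) : Submodule ℂ H :=
  T.graph.comap (LinearMap.prod LinearMap.id (z • LinearMap.id))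

/-- The multiplicity `mult(z, T)` of an eigenvalue. -/
def mult (z : ℂ) (T : H →ₗ.[ℂ] H) : ℕ := Module.finrank ℂ (eigenspace T z)

end Spectrum

/-! ### Lattices -/

/-- The plane `ℝ²` with its Euclidean norm. -/
abbrev Plane : Type := EuclideanSpace ℝ (Fin 2)

def v₁ (a : ℝ) : Plane := !₂[a * (√3 / 2), a * (1 / 2)]

def v₂ (a : ℝ) : Plane := !₂[a * (√3 / 2), a * (-1 / 2)]

/-- The triangular lattice `Λ = ℤ v₁ ⊕ ℤ v₂`. -/
def lattice (a : ℝ) : Set Plane := {x | ∃ m n : ℤ, x = (m : ℝ) • v₁ a + (n : ℝ) • v₂ a}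

/-- The second site of the honeycomb structure in the fundamental cell. -/
def x₀ (a : ℝ) : Plane := (2 / 3 : ℝ) • (v₁ a + v₂ a)

/-- The fundamental cell `Γ` of `Λ`, as a half-open parallelogram. -/
def cell (a : ℝ) : Set Plane :=
  {x | ∃ s ∈ Set.Ico (0 : ℝ) 1, ∃ t ∈ Set.Ico (0 : ℝ) 1, x = s • v₁ a + t • v₂ a}

def k₁ (a : ℝ) : Plane :=
  !₂[4 * Real.pi / (a * √3) * (1 / 2), 4 * Real.pi / (a * √3) * (√3 / 2)]

def k₂ (a : ℝ) : Plane :=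
  !₂[4 * Real.pi / (a * √3) * (1 / 2), 4 * Real.pi / (a * √3) * (-√3 / 2)]

/-- The dual lattice vector `ξ_m = m₁ k₁ + m₂ k₂`. -/
def ξ (a : ℝ) (m : ℤ × ℤ) : Plane := (m.1 : ℝ) • k₁ a + (m.2 : ℝ) • k₂ a

/-- The Dirac point `K`. -/
def diracPoint (a : ℝ) : Plane := (2 / 3 : ℝ) • k₁ a + (1 / 3 : ℝ) • k₂ a

/-! ### The space `L²_k(Γ)` and the free Floquet Laplacian -/

theorem isBounded_cell (a : ℝ) : Bornology.IsBounded (cell a) := by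
  refine isBounded_iff_forall_norm_le.2 ⟨‖v₁ a‖ + ‖v₂ a‖, ?_⟩
  rintro x ⟨s, hs, t, ht, rfl⟩
  have h1 : ‖s • v₁ a‖ ≤ ‖v₁ a‖ := by
    rw [norm_smul, Real.norm_of_nonneg hs.1]
    exact mul_le_of_le_one_left (norm_nonneg _) hs.2.le
  have h2 : ‖t • v₂ a‖ ≤ ‖v₂ a‖ := by
    rw [norm_smul, Real.norm_of_nonneg ht.1]
    exact mul_le_of_le_one_left (norm_nonneg _) ht.2.le
  exact (norm_add_le _ _).trans (add_le_add h1 h2)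

instance isFiniteMeasure_cell (a : ℝ) :
    IsFiniteMeasure ((volume : Measure Plane).restrict (cell a)) :=
  ⟨by simpa using (isBounded_cell a).measure_lt_top⟩

/-- `area(Γ)`. -/
def area (a : ℝ) : ℝ := (volume : Measure Plane).real (cell a)

/-- The Hilbert space `L²(Γ)`. A function `f` on the plane with `f (x + v_j) = e^{i k·v_j} f x` is
the same thing as its restriction to the fundamental cell, so this is also `L²_k(Γ)`,
for every quasi-momentum `k`. The inner product is conjugate-linear in the first argument. -/
abbrev L2 (a : ℝ) : Type := Lp ℂ 2 ((volume : Measure Plane).restrict (cell a))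

/-- The function `x ↦ e^{i (ξ_m + k)·x}`. -/
def planeWaveFun (a : ℝ) (k : Plane) (m : ℤ × ℤ) (x : Plane) : ℂ :=
  Complex.exp (Complex.I * ((inner ℝ (ξ a m + k) x : ℝ) : ℂ))

theorem memLp_planeWave (a : ℝ) (k : Plane) (m : ℤ × ℤ) :
    MemLp (planeWaveFun a k m) 2 ((volume : Measure Plane).restrict (cell a)) := by
  refine MemLp.of_bound (C := 1) ?_ (Eventually.of_forall fun x => ?_)
  · have : Continuous (planeWaveFun a k m) := by unfold planeWaveFun; fun_prop
    exact this.aestronglyMeasurable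
  · rw [planeWaveFun, mul_comm, Complex.norm_exp_ofReal_mul_I]

/-- The plane wave `e^{i (ξ_m + k)·x}` as an element of `L²_k(Γ)`. -/
def planeWave (a : ℝ) (k : Plane) (m : ℤ × ℤ) : L2 a := (memLp_planeWave a k m).toLp _

/-- The graph of `-Δ(k)`: pairs `(f, h)` of elements of `L²_k(Γ)` whose Fourier coefficients
`f_m`, `h_m` with respect to the plane waves `e^{i (ξ_m + k)·x}` satisfy
`h_m = |ξ_m + k|² f_m`. The first components are the `f` with `∑ |ξ_m + k|⁴ |f_m|² < ∞`,
that is, the space `H²_k(Γ)`. -/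
def freeGraph (a : ℝ) (k : Plane) : Submodule ℂ (L2 a × L2 a) where
  carrier := {p | ∀ m : ℤ × ℤ, inner ℂ (planeWave a k m) p.2 =
    ((‖ξ a m + k‖ ^ 2 : ℝ) : ℂ) * inner ℂ (planeWave a k m) p.1}
  add_mem' := by
    intro p q hp hq m
    rw [Prod.fst_add, Prod.snd_add, inner_add_right, inner_add_right, hp m, hq m, mul_add]
  zero_mem' := by intro m; simp
  smul_mem' := by
    intro c p hp m
    rw [Prod.smul_fst, Prod.smul_snd, inner_smul_right, inner_smul_right, hp m]
    ring

/-- The free Laplacian `-Δ(k)` in `L²_k(Γ)` with domain `H²_k(Γ)`. -/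
def freeLaplacian (a : ℝ) (k : Plane) : L2 a →ₗ.[ℂ] L2 a := (freeGraph a k).toLinearPMap

/-! ### Green's function -/

open Classical in
/-- The expression whose limit as `r → ∞` is `g_z(x, k)`: the sum over `|ξ_m + k| ≤ r`,
renormalized by `-(2π)⁻¹ ln r` for `x` in the lattice. -/
def greenTrunc (a : ℝ) (k : Plane) (z : ℂ) (x : Plane) (r : ℝ) : ℂ :=
  if x ∈ lattice a then
    (area a : ℂ)⁻¹ * (∑ᶠ m ∈ {m : ℤ × ℤ | ‖ξ a m + k‖ ≤ r},
      1 / (((‖ξ a m + k‖ ^ 2 : ℝ) : ℂ) - z)) - ((Real.log r / (2 * Real.pi) : ℝ) : ℂ)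
  else
    (area a : ℂ)⁻¹ * ∑ᶠ m ∈ {m : ℤ × ℤ | ‖ξ a m + k‖ ≤ r},
      planeWaveFun a k m x / (((‖ξ a m + k‖ ^ 2 : ℝ) : ℂ) - z)

/-- The value `g_z(x, k)`. -/
def greenValue (a : ℝ) (k : Plane) (z : ℂ) (x : Plane) : ℂ :=
  limUnder atTop (greenTrunc a k z x)

/-- The function `x ↦ g_z(x - y, k)` as an element of `L²_k(Γ)`; the series converges there. -/
def green (a : ℝ) (k : Plane) (z : ℂ) (y : Plane) : L2 a :=
  ∑' m : ℤ × ℤ, ((area a : ℂ)⁻¹ * planeWaveFun a k m (-y) /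
    (((‖ξ a m + k‖ ^ 2 : ℝ) : ℂ) - z)) • planeWave a k m

/-! ### Point scatterers -/

section Scatterers

variable {ι : Type*} [Fintype ι] [DecidableEq ι]

/-- The matrix `Γ_{α,Y}(z, k)` with entries `α_j δ_{jj'} - g_z(y_{j'} - y_j, k)`. -/
def gammaMatrix (a : ℝ) (k : Plane) (α : ι → ℝ) (y : ι → Plane) (z : ℂ) : Matrix ι ι ℂ :=
  Matrix.of fun j j' => (if j = j' then (α j : ℂ) else 0) - greenValue a k z (y j' - y j)

/-- The finite rank term of the resolvent formula:
`∑_{j,j'} [Γ_{α,Y}(z, k)⁻¹]_{jj'} (g_{z̄}(· - y_j, k), f) g_z(· - y_{j'}, k)`. -/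
def kreinTerm (a : ℝ) (k : Plane) (α : ι → ℝ) (y : ι → Plane) (z : ℂ) (f : L2 a) : L2 a :=
  ∑ j, ∑ j', ((gammaMatrix a k α y z)⁻¹ j j' * inner ℂ (green a k (conj z) (y j)) f) •
    green a k z (y j')

theorem kreinTerm_add (a : ℝ) (k : Plane) (α : ι → ℝ) (y : ι → Plane) (z : ℂ) (f g : L2 a) :
    kreinTerm a k α y z (f + g) = kreinTerm a k α y z f + kreinTerm a k α y z g := by
  simp only [kreinTerm, inner_add_right, mul_add, add_smul, Finset.sum_add_distrib]

theorem kreinTerm_smul (a : ℝ) (k : Plane) (α : ι → ℝ) (y : ι → Plane) (z c : ℂ) (f : L2 a) :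
    kreinTerm a k α y z (c • f) = c • kreinTerm a k α y z f := by
  simp only [kreinTerm, inner_smul_right, Finset.smul_sum, smul_smul]
  refine Finset.sum_congr rfl fun j _ => Finset.sum_congr rfl fun j' _ => ?_
  congr 1
  ring

/-- The graph of `-Δ_{α,Y}(k)`, given by its resolvent. A pair `(ψ, η)` belongs to it when, for
every `z ∉ σ(-Δ(k))` with `Γ_{α,Y}(z, k)` invertible, `ψ = R_z (η - z ψ)`, where
`R_z f = (-Δ(k) - z)⁻¹ f + ∑_{j,j'} [Γ_{α,Y}(z, k)⁻¹]_{jj'} (g_{z̄}(· - y_j), f) g_z(· - y_{j'})`.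
Here `φ` stands for `(-Δ(k) - z)⁻¹ (η - z ψ)`. -/
def scattererGraph (a : ℝ) (k : Plane) (α : ι → ℝ) (y : ι → Plane) :
    Submodule ℂ (L2 a × L2 a) where
  carrier := {p | ∀ z : ℂ, z ∉ opSpectrum (freeLaplacian a k) →
    IsUnit (gammaMatrix a k α y z).det →
    ∃ φ : (freeLaplacian a k).domain,
      freeLaplacian a k φ - z • (φ : L2 a) = p.2 - z • p.1 ∧
      p.1 = (φ : L2 a) + kreinTerm a k α y z (p.2 - z • p.1)}
  add_mem' := by
    intro p q hp hq z hz hΓ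
    obtain ⟨φ, h1, h2⟩ := hp z hz hΓ
    obtain ⟨χ, h3, h4⟩ := hq z hz hΓ
    have e : (p + q).2 - z • (p + q).1 = (p.2 - z • p.1) + (q.2 - z • q.1) := by
      rw [Prod.fst_add, Prod.snd_add, smul_add]; abel
    refine ⟨φ + χ, ?_, ?_⟩
    · rw [e, ← h1, ← h3, LinearPMap.map_add, Submodule.coe_add, smul_add]; abel
    · rw [e, kreinTerm_add, Prod.fst_add, Submodule.coe_add, add_add_add_comm, ← h2, ← h4]
  zero_mem' := by
    intro z _ _
    refine ⟨0, by simp, ?_⟩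
    have := kreinTerm_smul a k α y z 0 (0 : L2 a)
    simpa using this.symm
  smul_mem' := by
    intro c p hp z hz hΓ
    obtain ⟨φ, h1, h2⟩ := hp z hz hΓ
    have e : (c • p).2 - z • (c • p).1 = c • (p.2 - z • p.1) := by
      rw [Prod.smul_fst, Prod.smul_snd, smul_sub, smul_comm z c]
    refine ⟨c • φ, ?_, ?_⟩
    · rw [e, ← h1, LinearPMap.map_smul, Submodule.coe_smul, smul_sub, smul_comm z c]
    · rw [e, kreinTerm_smul, Prod.smul_fst, Submodule.coe_smul, ← smul_add, ← h2]

/-- The fiber operator `-Δ_{α,Y}(k)` in `L²_k(Γ)`, with point scatterers of strength `α_j` at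
the pairwise inequivalent sites `y_j`. -/
def scatterer (a : ℝ) (k : Plane) (α : ι → ℝ) (y : ι → Plane) : L2 a →ₗ.[ℂ] L2 a :=
  (scattererGraph a k α y).toLinearPMap

end Scatterers

/-- `-Δ_{α,{0}}(k)`: one scatterer per cell, on the triangular lattice. -/
def triangular (a α : ℝ) (k : Plane) : L2 a →ₗ.[ℂ] L2 a :=
  scatterer a k ![α] ![(0 : Plane)]

/-- `-Δ_{α,{0,x₀}}(k)`: two scatterers of equal strength per cell, on the honeycomb structure. -/
def honeycomb (a α : ℝ) (k : Plane) : L2 a →ₗ.[ℂ] L2 a :=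
  scatterer a k ![α, α] ![(0 : Plane), x₀ a]

end PointScatterer

end

open PointScatterer

noncomputable section

namespace PointScatterer

/-! The shifted dual lattice `K + ξ_m` is invariant under rotation by `2π/3`. The rotation preserves
`|ξ_m + K|` and multiplies every plane wave at `x₀` by one fixed cube root of unity different from
`1` (`norm_diracRotation`, `planeWaveFun_diracRotation`). Hence the truncated sum for `g_z(x₀, K)`
over any disk equals itself times that phase, so it vanishes for every radius, and likewise at
`-x₀`. The honeycomb matrix `Γ` is therefore scalar, `q(z) I` with `q(z) = α - g_z(0, K)`, and the
triangular matrix is the number `q(z)` itself.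

Both operators are instances of one abstract situation, `IsDecoupled`, in which the spectrum off the
free spectrum is the zero set of `q`, each zero having multiplicity equal to the number of sites.
The operator is given through its resolvent at all `z` with `q(z) ≠ 0`, so the key step rewrites
graph membership as a boundary condition at one arbitrary nonresonant `z`, including zeros of `q`
(`IsDecoupled.mem_scattererGraph_iff`). The condition can be moved between energies by the resolvent
identity: `q(w) - q(z)` is exactly the sum produced by one source, and the cross terms between two
sites vanish by the same rotation argument. If `q(z) ≠ 0`, Krein's formula is a bounded inverse; if
`q(z) = 0`, the charges are free and the eigenspace is spanned by the independent functions `g_z(· -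
y_j)`.

The analytic input is the Fourier basis of plane waves and the convergence of the renormalized sum
for `g_z(0, K)`, obtained by comparing a lattice sum with an integral. Some `w` with `q(w) ≠ 0` is
also needed, since otherwise the resolvent condition would be vacuous; `q` takes different values at
`i` and `-i`. -/

/-! ### Fourier series on the torus -/

/-- The Haar probability measure on the two-dimensional torus. -/
abbrev torusMeasure : Measure (UnitAddTorus (Fin 2)) :=
  Measure.pi fun _ => (AddCircle.haarAddCircle : Measure UnitAddCircle)

theorem integral_mFourier_torus (n : Fin 2 → ℤ) (hn : n ≠ 0) :
    ∫ t, UnitAddTorus.mFourier n t ∂torusMeasure = 0 := by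
  have h := (UnitAddTorus.orthonormal_mFourier (d := Fin 2)).2 (i := 0) (j := n) hn.symm
  simp only [ContinuousMap.inner_toLp, ← UnitAddTorus.mFourier_neg] at h
  rw [← h]
  refine integral_congr_ae (Eventually.of_forall fun t => ?_)
  simp [UnitAddTorus.mFourier_zero]

theorem ae_eq_zero_of_integral_mFourier (f : UnitAddTorus (Fin 2) → ℂ)
    (hf : MemLp f 2 torusMeasure)
    (h : ∀ n, ∫ t, UnitAddTorus.mFourier (-n) t * f t ∂torusMeasure = 0) :
    f =ᵐ[torusMeasure] 0 := by
  have hF : UnitAddTorus.mFourierBasis.repr (hf.toLp f) = 0 := by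
    ext n
    rw [UnitAddTorus.mFourierBasis_repr]
    refine Eq.trans ?_ (h n)
    refine integral_congr_ae ?_
    filter_upwards [hf.coeFn_toLp] with t ht
    rw [ht, smul_eq_mul]
  rw [LinearIsometryEquiv.map_eq_zero_iff] at hF
  have h2 := hf.coeFn_toLp
  rw [hF] at h2
  exact h2.symm.trans (Lp.coeFn_zero _ _ _)

/-- The lift of the torus to the half-open unit square. -/
def torusLift (t : UnitAddTorus (Fin 2)) : Fin 2 → ℝ := fun i => (AddCircle.equivIoc 1 0 (t i)).1

theorem coe_torusLift (t : UnitAddTorus (Fin 2)) (i : Fin 2) :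
    ((torusLift t i : ℝ) : UnitAddCircle) = t i :=
  (AddCircle.equivIoc (1 : ℝ) 0).symm_apply_apply (t i)

/-- The half-open unit square. -/
abbrev unitSquare : Set (Fin 2 → ℝ) := Set.univ.pi fun _ => Set.Ico (0 : ℝ) 1

theorem measurePreserving_torusLift :
    MeasurePreserving torusLift torusMeasure (volume.restrict unitSquare) := by
  set B : Set (Fin 2 → ℝ) :=
    {x | ∀ i, x i ∈ Set.Ioc ((0 : Fin 2 → ℝ) i) ((0 : Fin 2 → ℝ) i + 1)} with hB
  have h1 := UnitAddTorus.measurePreserving_equivPiIoc (d := Fin 2) (0 : Fin 2 → ℝ)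
  have h2 : MeasurePreserving (Subtype.val : B → Fin 2 → ℝ) (Measure.comap Subtype.val volume)
      (volume.restrict B) :=
    ⟨measurable_subtype_coe,
      map_comap_subtype_coe (MeasurableSet.univ_pi' fun i => measurableSet_Ioc) _⟩
  have h3 : MeasurePreserving torusLift torusMeasure (volume.restrict B) := h2.comp h1
  have e : B = Set.univ.pi fun _ => Set.Ioc (0 : ℝ) 1 := by
    ext x; simp [hB]
  -- The torus lifts to `(0,1]²`, while the cell is parametrized by `[0,1)²`; both agree with the
  -- closed square up to a null set.
  have h4 : (volume : Measure (Fin 2 → ℝ)).restrict B = volume.restrict unitSquare := by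
    rw [e]
    let μ : Fin 2 → Measure ℝ := fun _ => volume
    exact Measure.restrict_congr_set
      ((Measure.univ_pi_Ioc_ae_eq_Icc (μ := μ) (f := 0) (g := 1)).trans
        (Measure.univ_pi_Ico_ae_eq_Icc (μ := μ) (f := 0) (g := 1)).symm)
  rwa [h4] at h3

/-! ### Dual bases and the parametrization of the fundamental cell -/

/-- The linear map with `e₁ ↦ v`, `e₂ ↦ w`. -/
def spanMap (v w : Plane) (s : Fin 2 → ℝ) : Plane := s 0 • v + s 1 • w

theorem map_spanMap (v w : Plane) (h : v 0 * w 1 - v 1 * w 0 ≠ 0) :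
    Measure.map (spanMap v w) volume =
      ENNReal.ofReal |(v 0 * w 1 - v 1 * w 0)⁻¹| • (volume : Measure Plane) := by
  have hdet : (!![v 0, w 0; v 1, w 1] : Matrix (Fin 2) (Fin 2) ℝ).det = v 0 * w 1 - v 1 * w 0 := by
    rw [Matrix.det_fin_two_of]; ring
  have h1 := Real.map_matrix_volume_pi_eq_smul_volume_pi (M := !![v 0, w 0; v 1, w 1]) (by rwa
    [hdet])
  rw [hdet] at h1
  have h2 : spanMap v w = (WithLp.toLp 2) ∘ (Matrix.toLin' !![v 0, w 0; v 1, w 1]) := by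
    funext s
    ext i
    fin_cases i <;> simp [spanMap, dotProduct, Fin.sum_univ_two, mul_comm]
  have hp := PiLp.volume_preserving_toLp (Fin 2)
  rw [h2, ← Measure.map_map hp.measurable (LinearMap.continuous_of_finiteDimensional _).measurable,
    h1, Measure.map_smul, hp.map_eq]

theorem volume_unitSquare : (volume : Measure (Fin 2 → ℝ)) unitSquare = 1 := by
  rw [volume_pi_pi]; simp

theorem inner_plane (x y : Plane) : inner ℝ x y = x 0 * y 0 + x 1 * y 1 := by
  simp [PiLp.inner_apply, Fin.sum_univ_two, mul_comm]

section Duality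

variable {a : ℝ}

/-- Coordinates of a point with respect to `v₁`, `v₂`. -/
def cellCoord (a : ℝ) (x : Plane) : Fin 2 → ℝ :=
  ![inner ℝ (k₁ a) x / (2 * Real.pi), inner ℝ (k₂ a) x / (2 * Real.pi)]

/-- Coordinates of a point with respect to `k₁`, `k₂`. -/
def dualCoord (a : ℝ) (y : Plane) : Fin 2 → ℝ :=
  ![inner ℝ (v₁ a) y / (2 * Real.pi), inner ℝ (v₂ a) y / (2 * Real.pi)]

theorem continuous_cellCoord : Continuous (cellCoord a) := by
  refine continuous_pi fun i => ?_
  fin_cases i <;> simp [cellCoord] <;> fun_prop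

theorem continuous_dualCoord : Continuous (dualCoord a) := by
  refine continuous_pi fun i => ?_
  fin_cases i <;> simp [dualCoord] <;> fun_prop

theorem continuous_spanMap (v w : Plane) : Continuous (spanMap v w) := by
  unfold spanMap; fun_prop

theorem cellCoord_spanMap (ha : 0 < a) (s : Fin 2 → ℝ) :
    cellCoord a (spanMap (v₁ a) (v₂ a) s) = s := by
  have h0 : √3 ≠ 0 := by positivity
  have hp := Real.pi_ne_zero
  ext i
  fin_cases i <;> simp [cellCoord, spanMap, inner_plane, k₁, k₂, v₁, v₂] <;> field_simp <;>
    ring_nf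

theorem spanMap_cellCoord (ha : 0 < a) (x : Plane) :
    spanMap (v₁ a) (v₂ a) (cellCoord a x) = x := by
  have h0 : √3 ≠ 0 := by positivity
  have hp := Real.pi_ne_zero
  ext i
  fin_cases i <;> simp [cellCoord, spanMap, inner_plane, k₁, k₂, v₁, v₂] <;> field_simp <;>
    ring_nf

theorem dualCoord_spanMap (ha : 0 < a) (s : Fin 2 → ℝ) :
    dualCoord a (spanMap (k₁ a) (k₂ a) s) = s := by
  have h0 : √3 ≠ 0 := by positivity
  have hp := Real.pi_ne_zero
  ext i
  fin_cases i <;> simp [dualCoord, spanMap, inner_plane, k₁, k₂, v₁, v₂] <;> field_simp <;>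
    ring_nf

theorem spanMap_dualCoord (ha : 0 < a) (x : Plane) :
    spanMap (k₁ a) (k₂ a) (dualCoord a x) = x := by
  have h0 : √3 ≠ 0 := by positivity
  have hp := Real.pi_ne_zero
  ext i
  fin_cases i <;> simp [dualCoord, spanMap, inner_plane, k₁, k₂, v₁, v₂] <;> field_simp <;>
    ring_nf

theorem spanMap_preimage_cell (ha : 0 < a) : spanMap (v₁ a) (v₂ a) ⁻¹' cell a = unitSquare := by
  ext s
  simp only [Set.mem_preimage, cell, Set.mem_ofPred_eq, Set.mem_univ_pi]
  constructor
  · rintro ⟨s', hs', t', ht', e⟩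
    have e2 : spanMap (v₁ a) (v₂ a) s = spanMap (v₁ a) (v₂ a) ![s', t'] := e
    have e3 := congrArg (cellCoord a) e2
    rw [cellCoord_spanMap ha, cellCoord_spanMap ha] at e3
    intro i
    rw [e3]
    fin_cases i
    exacts [hs', ht']
  · intro h
    exact ⟨s 0, h 0, s 1, h 1, rfl⟩

theorem measurableSet_cell (ha : 0 < a) : MeasurableSet (cell a) := by
  have h : cell a = cellCoord a ⁻¹' unitSquare := by
    rw [← spanMap_preimage_cell ha, ← Set.preimage_comp]
    ext x
    simp [spanMap_cellCoord ha]
  rw [h]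
  exact continuous_cellCoord.measurable (MeasurableSet.univ_pi fun _ => measurableSet_Ico)

theorem map_spanMap_cell (ha : 0 < a) : Measure.map (spanMap (v₁ a) (v₂ a)) volume =
      ENNReal.ofReal (a ^ 2 * √3 / 2)⁻¹ • (volume : Measure Plane) := by
  have e : (v₁ a) 0 * (v₂ a) 1 - (v₁ a) 1 * (v₂ a) 0 = - (a ^ 2 * √3 / 2) := by
    simp [v₁, v₂]; ring
  have hpos : 0 < a ^ 2 * √3 / 2 := by positivity
  rw [map_spanMap _ _ (by rw [e]; exact neg_ne_zero.2 hpos.ne'), e, abs_inv, abs_neg, abs_of_pos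
    hpos]

theorem map_spanMap_dual (ha : 0 < a) : Measure.map (spanMap (k₁ a) (k₂ a)) volume =
      ENNReal.ofReal (a ^ 2 * √3 / 2 / (4 * Real.pi ^ 2)) • (volume : Measure Plane) := by
  have h3 : √3 ^ 2 = 3 := Real.sq_sqrt (by norm_num)
  have h0 : √3 ≠ 0 := by positivity
  have e : (k₁ a) 0 * (k₂ a) 1 - (k₁ a) 1 * (k₂ a) 0 = - (a ^ 2 * √3 / 2 / (4 * Real.pi ^ 2))⁻¹ :=
    by
    simp [k₁, k₂]; field_simp; norm_num
  have hpos : 0 < a ^ 2 * √3 / 2 / (4 * Real.pi ^ 2) := by positivity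
  rw [map_spanMap _ _ (by rw [e]; exact neg_ne_zero.2 (inv_pos.2 hpos).ne'), e, abs_inv, abs_neg,
    abs_of_pos (inv_pos.2 hpos), inv_inv]

theorem area_eq (ha : 0 < a) : area a = a ^ 2 * √3 / 2 := by
  have h := congrArg (fun μ => μ (cell a)) (map_spanMap_cell ha)
  have hpos : 0 < a ^ 2 * √3 / 2 := by positivity
  simp only [Measure.smul_apply, smul_eq_mul] at h
  rw [Measure.map_apply (continuous_spanMap _ _).measurable (measurableSet_cell ha),
    spanMap_preimage_cell ha, volume_unitSquare] at h
  have h2 := congrArg ENNReal.toReal h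
  rw [ENNReal.toReal_one, ENNReal.toReal_mul, ENNReal.toReal_ofReal (inv_pos.2 hpos).le] at h2
  have : area a = (volume (cell a)).toReal := rfl
  rw [this]
  field_simp at h2 ⊢
  linarith

theorem area_pos (ha : 0 < a) : 0 < area a := by rw [area_eq ha]; positivity

/-- The parametrization of the fundamental cell by the torus. -/
def cellParam (a : ℝ) (t : UnitAddTorus (Fin 2)) : Plane := spanMap (v₁ a) (v₂ a) (torusLift t)

theorem map_cellParam (ha : 0 < a) : Measure.map (cellParam a) torusMeasure =
    ENNReal.ofReal (area a)⁻¹ • (volume : Measure Plane).restrict (cell a) := by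
  have e : cellParam a = spanMap (v₁ a) (v₂ a) ∘ torusLift := rfl
  have hm := (continuous_spanMap (v₁ a) (v₂ a)).measurable
  rw [e, ← Measure.map_map hm measurePreserving_torusLift.measurable,
    measurePreserving_torusLift.map_eq, ← spanMap_preimage_cell ha,
    ← Measure.restrict_map hm (measurableSet_cell ha), map_spanMap_cell ha, area_eq ha,
      Measure.restrict_smul]

theorem measurable_cellParam : Measurable (cellParam a) :=
  (continuous_spanMap _ _).measurable.comp measurePreserving_torusLift.measurable

theorem integral_cellParam (ha : 0 < a) (f : Plane → ℂ)
    (hf : AEStronglyMeasurable f ((volume : Measure Plane).restrict (cell a))) :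
    ∫ t, f (cellParam a t) ∂torusMeasure = (area a : ℂ)⁻¹ * ∫ x in cell a, f x := by
  rw [← integral_map (φ := cellParam a) measurable_cellParam.aemeasurable, map_cellParam ha,
    integral_smul_measure,
    ENNReal.toReal_ofReal (inv_pos.2 (area_pos ha)).le]
  · simp
  · rw [map_cellParam ha]
    exact hf.smul_measure _

theorem inner_ξ_spanMap (ha : 0 < a) (m : ℤ × ℤ) (s : Fin 2 → ℝ) :
    inner ℝ (ξ a m) (spanMap (v₁ a) (v₂ a) s) = 2 * Real.pi * (m.1 * s 0 + m.2 * s 1) := by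
  have h := cellCoord_spanMap ha s
  have h0 := congrFun h 0
  have h1 := congrFun h 1
  simp only [cellCoord, Matrix.cons_val_zero, Matrix.cons_val_one] at h0 h1
  rw [div_eq_iff (by positivity)] at h0 h1
  rw [ξ, inner_add_left, real_inner_smul_left, real_inner_smul_left, h0, h1]
  ring

/-- Duality of the two bases turns `ξ_m · x` into `2π` times an integer combination of cell
coordinates, so only the factor `e^{i k·x}` distinguishes a plane wave from a torus character. -/
theorem planeWaveFun_cellParam (ha : 0 < a) (k : Plane) (m : ℤ × ℤ) (t : UnitAddTorus (Fin 2)) :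
    planeWaveFun a k m (cellParam a t) = UnitAddTorus.mFourier ![m.1, m.2] t *
      Complex.exp (Complex.I * (inner ℝ k (cellParam a t) : ℝ)) := by
  have h : UnitAddTorus.mFourier ![m.1, m.2] t =
      Complex.exp (Complex.I * (inner ℝ (ξ a m) (cellParam a t) : ℝ)) := by
    simp only [UnitAddTorus.mFourier, ContinuousMap.coe_mk, Fin.prod_univ_two]
    rw [← coe_torusLift t 0, ← coe_torusLift t 1, fourier_coe_apply, fourier_coe_apply, ←
      Complex.exp_add,
      cellParam, inner_ξ_spanMap ha]
    congr 1
    simp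
    ring
  rw [h, ← Complex.exp_add, planeWaveFun, inner_add_left]
  congr 1
  push_cast
  ring

end Duality

variable {a : ℝ}

/-! ### Plane waves as an orthogonal basis of `L²_k(Γ)` -/

theorem continuous_planeWaveFun (a : ℝ) (k : Plane) (m : ℤ × ℤ) : Continuous (planeWaveFun a k m)
    := by
  unfold planeWaveFun; fun_prop

theorem planeWaveFun_mul_conj (a : ℝ) (k x : Plane) (m : ℤ × ℤ) :
    planeWaveFun a k m x * conj (planeWaveFun a k m x) = 1 := by
  rw [Complex.mul_conj, Complex.normSq_eq_norm_sq, planeWaveFun, mul_comm,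
    Complex.norm_exp_ofReal_mul_I]
  simp

theorem inner_planeWave_left (a : ℝ) (k : Plane) (m : ℤ × ℤ) (f : L2 a) :
    inner ℂ (planeWave a k m) f = ∫ x in cell a, f x * conj (planeWaveFun a k m x) := by
  rw [L2.inner_def]
  refine integral_congr_ae ?_
  filter_upwards [(memLp_planeWave a k m).coeFn_toLp] with x hx
  rw [planeWave, hx, RCLike.inner_apply]

theorem exp_I_mul_conj (r : ℝ) : Complex.exp (Complex.I * r) * conj (Complex.exp (Complex.I * r)) =
    1 := by
  rw [Complex.mul_conj, Complex.normSq_eq_norm_sq, mul_comm, Complex.norm_exp_ofReal_mul_I]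
  simp

theorem inner_planeWave_planeWave (ha : 0 < a) (k : Plane) (m n : ℤ × ℤ) :
    inner ℂ (planeWave a k m) (planeWave a k n) = if m = n then (area a : ℂ) else 0 := by
  have hA : (area a : ℂ) ≠ 0 := by exact_mod_cast (area_pos ha).ne'
  have hc : Continuous fun x => planeWaveFun a k n x * conj (planeWaveFun a k m x) :=
    (continuous_planeWaveFun a k n).mul (Complex.continuous_conj.comp (continuous_planeWaveFun a k
      m))
  have h1 : inner ℂ (planeWave a k m) (planeWave a k n) =
      ∫ x in cell a, planeWaveFun a k n x * conj (planeWaveFun a k m x) := by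
    rw [inner_planeWave_left]
    refine integral_congr_ae ?_
    filter_upwards [(memLp_planeWave a k n).coeFn_toLp] with x hx
    rw [planeWave, hx]
  have h2 := integral_cellParam ha (fun x => planeWaveFun a k n x * conj (planeWaveFun a k m x))
    hc.aestronglyMeasurable
  have h3 : ∀ t, planeWaveFun a k n (cellParam a t) * conj (planeWaveFun a k m (cellParam a t)) =
      UnitAddTorus.mFourier (![n.1, n.2] + -![m.1, m.2]) t := by
    intro t
    rw [planeWaveFun_cellParam ha, planeWaveFun_cellParam ha, UnitAddTorus.mFourier_add,
      UnitAddTorus.mFourier_neg, map_mul, mul_mul_mul_comm, exp_I_mul_conj, mul_one]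
  simp only [h3] at h2
  rw [h1, eq_comm, ← mul_right_inj' (inv_ne_zero hA), ← h2]
  split_ifs with h
  · subst h
    rw [add_neg_cancel, UnitAddTorus.mFourier_zero, inv_mul_cancel₀ hA]
    simp
  · rw [integral_mFourier_torus, mul_zero]
    intro h0
    apply h
    have e := add_neg_eq_zero.1 h0
    exact Prod.ext (congrFun e 0).symm (congrFun e 1).symm

/-- Removing the factor `e^{i k·x}` from `f` leaves a function whose torus Fourier coefficients all
vanish, so completeness of the characters applies. -/
theorem eq_zero_of_inner_planeWave (ha : 0 < a) (k : Plane) (f : L2 a)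
    (hf : ∀ m, inner ℂ (planeWave a k m) f = 0) : f = 0 := by
  have hA : ENNReal.ofReal (area a)⁻¹ ≠ 0 := by
    simpa using area_pos ha
  set g : Plane → ℂ := fun x => f x * conj (Complex.exp (Complex.I * (inner ℝ k x : ℝ))) with hg
  have hgm : MemLp g 2 ((volume : Measure Plane).restrict (cell a)) := by
    refine (Lp.memLp f).mono ?_ (Eventually.of_forall fun x => ?_)
    · refine (Lp.aestronglyMeasurable f).mul (Continuous.aestronglyMeasurable ?_)
      fun_prop
    · rw [hg, norm_mul, RCLike.norm_conj, mul_comm Complex.I, Complex.norm_exp_ofReal_mul_I,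
        mul_one]
  have hgm2 : MemLp g 2 (Measure.map (cellParam a) torusMeasure) := by
    rw [map_cellParam ha]
    exact hgm.smul_measure (by simp)
  have h0 : (g ∘ cellParam a) =ᵐ[torusMeasure] 0 := by
    refine ae_eq_zero_of_integral_mFourier _
      ((memLp_map_measure_iff hgm2.1 measurable_cellParam.aemeasurable).1 hgm2) fun n => ?_
    have h1 := integral_cellParam ha (fun x => f x * conj (planeWaveFun a k (n 0, n 1) x))
      ((Lp.aestronglyMeasurable f).mul
        (Complex.continuous_conj.comp (continuous_planeWaveFun a k _)).aestronglyMeasurable)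
    rw [← inner_planeWave_left, hf, mul_zero] at h1
    rw [← h1]
    refine integral_congr_ae (Eventually.of_forall fun t => ?_)
    have e : ![n 0, n 1] = n := by ext i; fin_cases i <;> rfl
    simp only [planeWaveFun_cellParam ha, UnitAddTorus.mFourier_neg, Function.comp, hg, map_mul, e]
    ring
  have h1 : g =ᵐ[Measure.map (cellParam a) torusMeasure] 0 := by
    -- Transferring an a.e. statement to the pushforward requires a measurable zero set, hence the
    -- passage to a strongly measurable representative.
    have hz := (ae_map_iff measurable_cellParam.aemeasurable (p := fun x => hgm2.1.mk g x = 0)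
      (hgm2.1.stronglyMeasurable_mk.measurable (measurableSet_singleton 0))).2 (by
        filter_upwards [h0, ae_of_ae_map measurable_cellParam.aemeasurable hgm2.1.ae_eq_mk] with t
          ht ht2
        rw [← ht2]; exact ht)
    filter_upwards [hz, hgm2.1.ae_eq_mk] with x hx hx2
    rw [hx2]; exact hx
  rw [map_cellParam ha] at h1
  have h2 : g =ᵐ[(volume : Measure Plane).restrict (cell a)] 0 :=
    (Measure.absolutelyContinuous_smul hA).ae_eq h1
  refine (Lp.eq_zero_iff_ae_eq_zero (f := f)).2 ?_
  filter_upwards [h2] with x hx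
  have := mul_eq_zero.1 hx
  simpa [Complex.exp_ne_zero] using this

theorem orthonormal_planeWave (ha : 0 < a) (k : Plane) :
    Orthonormal ℂ fun m => ((√(area a) : ℝ) : ℂ)⁻¹ • planeWave a k m := by
  have hA := area_pos ha
  rw [orthonormal_iff_ite]
  intro m n
  rw [inner_smul_left, inner_smul_right, inner_planeWave_planeWave ha]
  split_ifs
  · rw [map_inv₀, Complex.conj_ofReal, ← mul_assoc, ← mul_inv, ← Complex.ofReal_mul,
      Real.mul_self_sqrt hA.le, inv_mul_cancel₀]
    exact_mod_cast hA.ne'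
  · simp

/-- The normalized plane waves as a Hilbert basis of `L²_k(Γ)`. -/
def planeWaveBasis (ha : 0 < a) (k : Plane) : HilbertBasis (ℤ × ℤ) ℂ (L2 a) :=
  HilbertBasis.mkOfOrthogonalEqBot (orthonormal_planeWave ha k) (by
    rw [Submodule.eq_bot_iff]
    intro f hf
    refine eq_zero_of_inner_planeWave ha k f fun m => ?_
    have h := (Submodule.mem_orthogonal _ _).1 hf _ (Submodule.subset_span ⟨m, rfl⟩)
    have hA : ((√(area a) : ℝ) : ℂ) ≠ 0 := by
      exact_mod_cast (Real.sqrt_pos.2 (area_pos ha)).ne'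
    rw [inner_smul_left] at h
    simpa [hA] using h)

theorem planeWaveBasis_apply (ha : 0 < a) (k : Plane) (m : ℤ × ℤ) :
    planeWaveBasis ha k m = ((√(area a) : ℝ) : ℂ)⁻¹ • planeWave a k m := by
  rw [planeWaveBasis, HilbertBasis.coe_mkOfOrthogonalEqBot]

/-- The Fourier coefficients of `f` with respect to the (unnormalized) plane waves. -/
abbrev coef (k : Plane) (f : L2 a) (m : ℤ × ℤ) : ℂ := inner ℂ (planeWave a k m) f

theorem ext_coef (ha : 0 < a) (k : Plane) {f g : L2 a} (h : ∀ m, coef k f m = coef k g m) :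
    f = g := by
  rw [← sub_eq_zero]
  refine eq_zero_of_inner_planeWave ha k _ fun m => ?_
  rw [inner_sub_right, sub_eq_zero]
  exact h m

theorem hasSum_coef (ha : 0 < a) (k : Plane) (f g : L2 a) :
    HasSum (fun m => (area a : ℂ)⁻¹ * (conj (coef k f m) * coef k g m)) (inner ℂ f g) := by
  refine ((planeWaveBasis ha k).hasSum_inner_mul_inner f g).congr_fun fun m => ?_
  rw [planeWaveBasis_apply, inner_smul_left, inner_smul_right, coef, coef, inner_conj_symm,
    map_inv₀, Complex.conj_ofReal]
  have : (area a : ℂ) = ((√(area a) : ℝ) : ℂ) * ((√(area a) : ℝ) : ℂ) := by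
    rw [← Complex.ofReal_mul, Real.mul_self_sqrt (area_pos ha).le]
  rw [this, mul_inv]
  ring

/-- Riesz–Fischer for the unnormalized plane waves; their squared norm is the area, which accounts
for the factor `area⁻¹` in the expansion. -/
theorem exists_coef_eq (ha : 0 < a) (k : Plane) (c : ℤ × ℤ → ℂ)
    (hc : Summable fun m => ‖c m‖ ^ 2) :
    ∃ f : L2 a, HasSum (fun m => ((area a : ℂ)⁻¹ * c m) • planeWave a k m) f ∧
      (∀ m, coef k f m = c m) := by
  set s : ℂ := ((√(area a) : ℝ) : ℂ) with hs
  have hs0 : s ≠ 0 := by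
    rw [hs]; exact_mod_cast (Real.sqrt_pos.2 (area_pos ha)).ne'
  have hss : (area a : ℂ) = s * s := by
    rw [hs, ← Complex.ofReal_mul, Real.mul_self_sqrt (area_pos ha).le]
  have hmem : Memℓp (fun m => s⁻¹ * c m) 2 := by
    refine memℓp_gen ?_
    simp only [norm_mul, ENNReal.toReal_ofNat, Real.rpow_ofNat, mul_pow]
    exact hc.mul_left _
  refine ⟨(planeWaveBasis ha k).repr.symm ⟨_, hmem⟩, ?_, fun m => ?_⟩
  · refine ((planeWaveBasis ha k).hasSum_repr_symm ⟨_, hmem⟩).congr_fun fun m => ?_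
    rw [planeWaveBasis_apply, smul_smul, hss]
    change _ = (s⁻¹ * c m * s⁻¹) • _
    congr 1
    rw [mul_inv]; ring
  · have h := (planeWaveBasis ha k).repr_apply_apply ((planeWaveBasis ha k).repr.symm ⟨_, hmem⟩) m
    rw [LinearIsometryEquiv.apply_symm_apply, planeWaveBasis_apply, inner_smul_left, map_inv₀,
      Complex.conj_ofReal] at h
    exact (mul_left_cancel₀ (inv_ne_zero hs0) h).symm

theorem hasSum_norm_coef_sq (ha : 0 < a) (k : Plane) (f : L2 a) :
    HasSum (fun m => (area a)⁻¹ * ‖coef k f m‖ ^ 2) (‖f‖ ^ 2) := by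
  have h := Complex.hasSum_re (hasSum_coef ha k f f)
  rw [← inner_self_eq_norm_sq (𝕜 := ℂ)]
  refine h.congr_fun fun m => ?_
  rw [Complex.conj_mul', ← Complex.ofReal_pow, ← Complex.ofReal_inv, ← Complex.ofReal_mul,
    Complex.ofReal_re]

/-! ### Lattice sums compared with integrals over a tiling of the dual plane -/

/-- The index of the cell of the shifted dual lattice `k + ξ_m` that contains `y`. -/
def tileIndex (a : ℝ) (k y : Plane) : ℤ × ℤ :=
  (⌊dualCoord a (y - k) 0⌋, ⌊dualCoord a (y - k) 1⌋)

theorem measurable_tileIndex (k : Plane) : Measurable (tileIndex a k) := by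
  have h : Measurable fun y => dualCoord a (y - k) :=
    (continuous_dualCoord.comp (continuous_id.sub continuous_const)).measurable
  exact ((measurable_pi_apply 0).comp h).floor.prodMk ((measurable_pi_apply 1).comp h).floor

/-- The cells of the shifted dual lattice. -/
def tile (a : ℝ) (k : Plane) (m : ℤ × ℤ) : Set Plane := tileIndex a k ⁻¹' {m}

theorem measurableSet_tile (k : Plane) (m : ℤ × ℤ) : MeasurableSet (tile a k m) :=
  measurable_tileIndex k (measurableSet_singleton m)

theorem volume_real_tile (ha : 0 < a) (k : Plane) (m : ℤ × ℤ) :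
    (volume : Measure Plane).real (tile a k m) = 4 * Real.pi ^ 2 / area a := by
  have hA := area_pos ha
  set B : Set (Fin 2 → ℝ) := Set.univ.pi fun i => Set.Ico ((![m.1, m.2] i : ℤ) : ℝ) ((![m.1, m.2] i
    : ℤ) + 1)
  have hB : MeasurableSet B := MeasurableSet.univ_pi fun _ => measurableSet_Ico
  have h1 : tile a k m = (fun y => y - k) ⁻¹' (dualCoord a ⁻¹' B) := by
    ext y
    simp [tile, tileIndex, B, Prod.ext_iff, Int.floor_eq_iff]
  have h2 : spanMap (k₁ a) (k₂ a) ⁻¹' (dualCoord a ⁻¹' B) = B := by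
    ext s; simp [dualCoord_spanMap ha]
  have h3 : (volume : Measure Plane) (tile a k m) = volume (dualCoord a ⁻¹' B) := by
    rw [h1]
    exact (measurePreserving_sub_right volume k).measure_preimage
      (continuous_dualCoord.measurable hB).nullMeasurableSet
  have h4 := congrArg (fun μ => μ (dualCoord a ⁻¹' B)) (map_spanMap_dual ha)
  simp only [Measure.smul_apply, smul_eq_mul] at h4
  rw [Measure.map_apply (continuous_spanMap _ _).measurable (continuous_dualCoord.measurable hB),
    h2, volume_pi_pi, ← h3, ← area_eq ha] at h4
  have h5 := congrArg ENNReal.toReal h4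
  rw [ENNReal.toReal_mul, ENNReal.toReal_ofReal (by positivity)] at h5
  simp at h5
  rw [Measure.real]
  field_simp at h5 ⊢
  linarith

theorem norm_sub_tileIndex_le (ha : 0 < a) (k y : Plane) :
    ‖y - (ξ a (tileIndex a k y) + k)‖ ≤ ‖k₁ a‖ + ‖k₂ a‖ := by
  have h : y - (ξ a (tileIndex a k y) + k) =
      Int.fract (dualCoord a (y - k) 0) • k₁ a + Int.fract (dualCoord a (y - k) 1) • k₂ a := by
    have e : y - (ξ a (tileIndex a k y) + k) = spanMap (k₁ a) (k₂ a) (dualCoord a (y - k)) - ξ a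
      (tileIndex a k y) := by
      rw [spanMap_dualCoord ha]; abel
    rw [e, Int.fract, Int.fract, spanMap, ξ, tileIndex, sub_smul, sub_smul]
    abel
  rw [h]
  refine (norm_add_le _ _).trans (add_le_add ?_ ?_)
  all_goals
    rw [norm_smul, Real.norm_of_nonneg (Int.fract_nonneg _)]
    exact mul_le_of_le_one_left (norm_nonneg _) (Int.fract_lt_one _).le

/-- The radial weight `(1 + |y|²)⁻¹`. -/
def weight (y : Plane) : ℝ := (1 + ‖y‖ ^ 2)⁻¹

theorem weight_pos (y : Plane) : 0 < weight y := by unfold weight; positivity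

theorem continuous_weight : Continuous weight := by
  unfold weight
  exact (by fun_prop : Continuous fun y : Plane => 1 + ‖y‖ ^ 2).inv₀ fun y => by positivity

theorem weight_le (y : Plane) : weight y ≤ 2 / (1 + ‖y‖) ^ 2 := by
  rw [weight, inv_eq_one_div, div_le_div_iff₀ (by positivity) (by positivity)]
  nlinarith [sq_nonneg (1 - ‖y‖)]

theorem weight_le_of_norm_sub_le {y p : Plane} {d : ℝ} (h : ‖y - p‖ ≤ d) :
    weight p ≤ 2 * (1 + d) ^ 2 / (1 + ‖y‖) ^ 2 := by
  have hd : 0 ≤ d := (norm_nonneg _).trans h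
  have h1 : ‖y‖ ≤ ‖p‖ + d := by linarith [norm_le_norm_add_norm_sub' y p]
  have h2 : 1 + ‖y‖ ≤ (1 + d) * (1 + ‖p‖) := by nlinarith [norm_nonneg p]
  refine (weight_le p).trans ?_
  rw [div_le_div_iff₀ (by positivity) (by positivity)]
  have h3 : (1 + ‖y‖) ^ 2 ≤ ((1 + d) * (1 + ‖p‖)) ^ 2 := by gcongr
  nlinarith

/-- The difference is `(|y|² - |p|²)` times the product of the weights. This gains one power of
decay over the weight itself, and `|y|⁻³` is integrable in the plane whereas `|y|⁻²` is not. -/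
theorem abs_weight_sub_le {y p : Plane} {d : ℝ} (h : ‖y - p‖ ≤ d) :
    |weight p - weight y| ≤ 4 * d * (2 + d) * (1 + d) ^ 2 * ((1 + ‖y‖) ^ 3)⁻¹ := by
  have hd : 0 ≤ d := (norm_nonneg _).trans h
  have h1 : ‖p‖ ≤ ‖y‖ + d := by linarith [norm_le_norm_add_norm_sub' p y, norm_sub_rev p y]
  have e : weight p - weight y = (‖y‖ - ‖p‖) * (‖y‖ + ‖p‖) * (weight p * weight y) := by
    unfold weight; field_simp; ring
  rw [e, abs_mul, abs_mul, abs_of_pos (mul_pos (weight_pos p) (weight_pos y)),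
    abs_of_nonneg (by positivity : 0 ≤ ‖y‖ + ‖p‖)]
  have h2 : |‖y‖ - ‖p‖| ≤ d := (abs_norm_sub_norm_le y p).trans h
  have h3 : ‖y‖ + ‖p‖ ≤ (2 + d) * (1 + ‖y‖) := by nlinarith [norm_nonneg y]
  have hw : 0 < weight p := weight_pos p
  have hw' : 0 < weight y := weight_pos y
  calc |‖y‖ - ‖p‖| * (‖y‖ + ‖p‖) * (weight p * weight y)
      ≤ d * ((2 + d) * (1 + ‖y‖)) * ((2 * (1 + d) ^ 2 / (1 + ‖y‖) ^ 2) * (2 / (1 + ‖y‖) ^ 2)) := by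
        gcongr
        · exact weight_le_of_norm_sub_le h
        · exact weight_le y
    _ = 4 * d * (2 + d) * (1 + d) ^ 2 * ((1 + ‖y‖) ^ 3)⁻¹ := by
        field_simp; ring

/-- The weight at the lattice point of the cell. -/
def stepWeight (a : ℝ) (k y : Plane) : ℝ := weight (ξ a (tileIndex a k y) + k)

theorem measurable_stepWeight (k : Plane) : Measurable (stepWeight a k) :=
  (measurable_of_countable fun m : ℤ × ℤ => weight (ξ a m + k)).comp (measurable_tileIndex k)

theorem integrable_one_add_norm_pow_inv {n : ℕ} (hn : 2 < n) :
    Integrable fun y : Plane => ((1 + ‖y‖) ^ n)⁻¹ := by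
  have h := integrable_one_add_norm (E := Plane) (μ := volume) (r := n) (by
    rw [finrank_euclideanSpace_fin]; exact_mod_cast hn)
  refine h.congr (Eventually.of_forall fun y => ?_)
  simp only
  rw [Real.rpow_neg (by positivity), Real.rpow_natCast]

theorem integrable_stepWeight_sq (ha : 0 < a) (k : Plane) :
    Integrable fun y => stepWeight a k y ^ 2 := by
  set d := ‖k₁ a‖ + ‖k₂ a‖
  refine ((integrable_one_add_norm_pow_inv (n := 4) (by norm_num)).const_mul
    ((2 * (1 + d) ^ 2) ^ 2)).mono' ((measurable_stepWeight k).pow_const 2).aestronglyMeasurable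
    (Eventually.of_forall fun y => ?_)
  rw [Real.norm_of_nonneg (sq_nonneg _)]
  have h := weight_le_of_norm_sub_le (norm_sub_tileIndex_le ha k y)
  calc stepWeight a k y ^ 2 ≤ (2 * (1 + d) ^ 2 / (1 + ‖y‖) ^ 2) ^ 2 :=
        pow_le_pow_left₀ (weight_pos _).le h 2
    _ = _ := by field_simp

theorem integrable_stepWeight_sub (ha : 0 < a) (k : Plane) :
    Integrable fun y => stepWeight a k y - weight y := by
  set d := ‖k₁ a‖ + ‖k₂ a‖
  refine ((integrable_one_add_norm_pow_inv (n := 3) (by norm_num)).const_mul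
    (4 * d * (2 + d) * (1 + d) ^ 2)).mono'
    ((measurable_stepWeight k).sub continuous_weight.measurable).aestronglyMeasurable
    (Eventually.of_forall fun y => ?_)
  exact abs_weight_sub_le (norm_sub_tileIndex_le ha k y)

theorem setIntegral_tile (ha : 0 < a) (k : Plane) (g : ℤ × ℤ → ℝ) (m : ℤ × ℤ) :
    ∫ y in tile a k m, g (tileIndex a k y) = 4 * Real.pi ^ 2 / area a * g m := by
  rw [setIntegral_congr_fun (g := fun _ => g m) (measurableSet_tile k m)
    (fun y hy => by rw [show tileIndex a k y = m from hy]), setIntegral_const, volume_real_tile ha,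
    smul_eq_mul]

theorem pairwise_disjoint_tile (k : Plane) : Pairwise (Function.onFun Disjoint (tile a k)) :=
  fun _ _ h => Disjoint.preimage _ (Set.disjoint_singleton.2 h)

/-- Up to the constant tile area this is the integral of the squared step function, which decays
like `|y|⁻⁴`. -/
theorem summable_weight_sq (ha : 0 < a) (k : Plane) :
    Summable fun m : ℤ × ℤ => weight (ξ a m + k) ^ 2 := by
  have hA := area_pos ha
  have h := hasSum_integral_iUnion (measurableSet_tile k) (pairwise_disjoint_tile (a := a) k)
    (integrable_stepWeight_sq ha k).integrableOn
  have e : ∀ m, ∫ y in tile a k m, stepWeight a k y ^ 2 =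
      4 * Real.pi ^ 2 / area a * weight (ξ a m + k) ^ 2 := fun m =>
    setIntegral_tile ha k (fun m => weight (ξ a m + k) ^ 2) m
  simp only [e] at h
  exact (summable_mul_left_iff (by positivity)).1 h.summable

theorem tendsto_weight_cofinite (ha : 0 < a) (k : Plane) :
    Tendsto (fun m : ℤ × ℤ => weight (ξ a m + k)) cofinite (𝓝 0) := by
  have h := (summable_weight_sq ha k).tendsto_cofinite_zero.sqrt
  simpa [Real.sqrt_sq (weight_pos _).le] using h

theorem finite_norm_le (ha : 0 < a) (k : Plane) (r : ℝ) :
    {m : ℤ × ℤ | ‖ξ a m + k‖ ≤ r}.Finite := by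
  have h := (tendsto_weight_cofinite ha k).eventually_lt_const
    (show (0 : ℝ) < (1 + r ^ 2)⁻¹ by positivity)
  refine Set.Finite.subset h fun m hm => ?_
  simp only [Set.mem_ofPred_eq, Set.mem_compl_iff, not_lt] at hm ⊢
  rw [weight]
  gcongr

theorem integral_weight_closedBall {ρ : ℝ} (hρ : 0 ≤ ρ) :
    ∫ y in Metric.closedBall (0 : Plane) ρ, weight y = Real.pi * Real.log (1 + ρ ^ 2) := by
  have h1 : ∫ y in Metric.closedBall (0 : Plane) ρ, weight y =
      ∫ y : Plane, (Set.Iic ρ).indicator (fun s : ℝ => (1 + s ^ 2)⁻¹) ‖y‖ := by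
    rw [← integral_indicator measurableSet_closedBall]
    refine integral_congr_ae (Eventually.of_forall fun y => ?_)
    simp only [Set.indicator, mem_closedBall_zero_iff, Set.mem_Iic, weight]
  have h2 : ∫ s in Set.Ioi (0 : ℝ), s * (Set.Iic ρ).indicator (fun s : ℝ => (1 + s ^ 2)⁻¹) s =
      ∫ s in (0 : ℝ)..ρ, s * (1 + s ^ 2)⁻¹ := by
    rw [intervalIntegral.integral_of_le hρ, ← Set.Ioi_inter_Iic, ← setIntegral_indicator
      measurableSet_Iic]
    simp only [Set.indicator_apply, mul_ite, mul_zero]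
  have h3 : ∫ s in (0 : ℝ)..ρ, s * (1 + s ^ 2)⁻¹ = Real.log (1 + ρ ^ 2) / 2 := by
    rw [intervalIntegral.integral_eq_sub_of_hasDerivAt (f := fun s => Real.log (1 + s ^ 2) / 2)]
    · simp
    · intro s _
      have h := ((((hasDerivAt_id s).pow 2).const_add 1).log (by simp; positivity)).div_const 2
      refine h.congr_deriv ?_
      simp
      field_simp
    · refine ContinuousOn.intervalIntegrable (Continuous.continuousOn ?_)
      exact continuous_id.mul ((by fun_prop : Continuous fun s : ℝ => 1 + s ^ 2).inv₀ fun s =>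
        by positivity)
  have h4 : (volume : Measure Plane).real (Metric.ball 0 1) = Real.pi := by
    rw [Measure.real, EuclideanSpace.volume_ball_fin_two]
    simp [Real.pi_pos.le]
  rw [h1, integral_fun_norm_addHaar, finrank_euclideanSpace_fin, h4]
  simp only [Nat.add_one_sub_one, pow_one, smul_eq_mul, nsmul_eq_mul]
  rw [h2, h3]
  push_cast
  ring

theorem tendsto_log_shift (d : ℝ) :
    Tendsto (fun r : ℝ => Real.pi * Real.log (1 + (r + d) ^ 2) - 2 * Real.pi * Real.log r) atTop (𝓝
      0) := by
  have h1 : Tendsto (fun r : ℝ => (r⁻¹) ^ 2 + (1 + d * r⁻¹) ^ 2) atTop (𝓝 ((0 : ℝ) ^ 2 + (1 + d *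
    0) ^ 2)) :=
    (tendsto_inv_atTop_zero.pow 2).add ((tendsto_const_nhds.add (tendsto_inv_atTop_zero.const_mul
      d)).pow 2)
  have h2 := (h1.log (by norm_num)).const_mul Real.pi
  simp only [mul_zero, add_zero, one_pow, zero_add, Real.log_one, ne_eq, OfNat.ofNat_ne_zero,
    not_false_eq_true, zero_pow] at h2
  refine h2.congr' ?_
  filter_upwards [eventually_gt_atTop 0] with r hr
  have e : (r⁻¹) ^ 2 + (1 + d * r⁻¹) ^ 2 = (1 + (r + d) ^ 2) / r ^ 2 := by field_simp
  rw [e, Real.log_div (by positivity) (by positivity), Real.log_pow]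
  push_cast
  ring

/-- The union of the cells whose lattice point has norm at most `r`. -/
def tileBall (a : ℝ) (k : Plane) (r : ℝ) : Set Plane := {y | ‖ξ a (tileIndex a k y) + k‖ ≤ r}

theorem measurableSet_tileBall (k : Plane) (r : ℝ) : MeasurableSet (tileBall a k r) :=
  measurable_tileIndex k (Set.to_countable {m : ℤ × ℤ | ‖ξ a m + k‖ ≤ r}).measurableSet

theorem closedBall_subset_tileBall (ha : 0 < a) (k : Plane) (r : ℝ) :
    Metric.closedBall 0 (r - (‖k₁ a‖ + ‖k₂ a‖)) ⊆ tileBall a k r := by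
  intro y hy
  have h := norm_sub_tileIndex_le ha k y
  rw [mem_closedBall_zero_iff] at hy
  change ‖_‖ ≤ r
  have := norm_le_norm_add_norm_sub y (ξ a (tileIndex a k y) + k)
  linarith

theorem tileBall_subset_closedBall (ha : 0 < a) (k : Plane) (r : ℝ) :
    tileBall a k r ⊆ Metric.closedBall 0 (r + (‖k₁ a‖ + ‖k₂ a‖)) := by
  intro y hy
  have h := norm_sub_tileIndex_le ha k y
  rw [mem_closedBall_zero_iff]
  change ‖_‖ ≤ r at hy
  have := norm_le_norm_add_norm_sub' y (ξ a (tileIndex a k y) + k)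
  linarith

theorem integrableOn_weight_closedBall (ρ : ℝ) :
    IntegrableOn weight (Metric.closedBall (0 : Plane) ρ) :=
  continuous_weight.continuousOn.integrableOn_compact (isCompact_closedBall _ _)

theorem integrableOn_weight_tileBall (ha : 0 < a) (k : Plane) (r : ℝ) :
    IntegrableOn weight (tileBall a k r) :=
  (integrableOn_weight_closedBall _).mono_set (tileBall_subset_closedBall ha k r)

/-- The union of tiles lies between disks of radii `r - d` and `r + d`, and replacing `r` by `r ± d`
changes the logarithm only by `o(1)`. -/
theorem tendsto_integral_weight_tileBall (ha : 0 < a) (k : Plane) :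
    Tendsto (fun r => (∫ y in tileBall a k r, weight y) - 2 * Real.pi * Real.log r) atTop (𝓝 0) :=
      by
  set d := ‖k₁ a‖ + ‖k₂ a‖ with hd
  have hd0 : 0 ≤ d := by positivity
  refine tendsto_of_tendsto_of_tendsto_of_le_of_le' (tendsto_log_shift (-d)) (tendsto_log_shift d)
    ?_ ?_
  · filter_upwards [eventually_ge_atTop d] with r hr
    rw [← integral_weight_closedBall (by linarith), ← sub_eq_add_neg]
    refine sub_le_sub_right (setIntegral_mono_set (integrableOn_weight_tileBall ha k r)
      (Eventually.of_forall fun y => (weight_pos y).le) ?_) _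
    exact (closedBall_subset_tileBall ha k r).eventuallyLE
  · filter_upwards [eventually_ge_atTop 0] with r hr
    rw [← integral_weight_closedBall (by linarith)]
    refine sub_le_sub_right (setIntegral_mono_set (integrableOn_weight_closedBall _)
      (Eventually.of_forall fun y => (weight_pos y).le) ?_) _
    exact (tileBall_subset_closedBall ha k r).eventuallyLE

theorem integral_stepWeight_tileBall (ha : 0 < a) (k : Plane) (r : ℝ) :
    ∫ y in tileBall a k r, stepWeight a k y =
      4 * Real.pi ^ 2 / area a * ∑ m ∈ (finite_norm_le ha k r).toFinset, weight (ξ a m + k) := by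
  have h : tileBall a k r = ⋃ m ∈ (finite_norm_le ha k r).toFinset, tile a k m := by
    ext y
    simp [tileBall, tile]
  have hi : IntegrableOn (stepWeight a k) (tileBall a k r) := by
    have h2 := (integrable_stepWeight_sub ha k).integrableOn.add (integrableOn_weight_tileBall ha k
      r)
    exact h2.congr (Eventually.of_forall fun y => by simp)
  rw [h] at hi ⊢
  rw [integral_biUnion_finset _ (fun m _ => measurableSet_tile k m)
    ((pairwise_disjoint_tile k).set_pairwise _) fun m hm => hi.mono_set (Set.subset_biUnion_of_mem
      (u := tile a k) hm), Finset.mul_sum]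
  exact Finset.sum_congr rfl fun m _ => setIntegral_tile ha k (fun m => weight (ξ a m + k)) m

/-- The sum is the integral of the step function over the union of tiles. Its difference from the
smooth weight is integrable, and the smooth part contributes `2π ln r + o(1)`; after division by
`4π²` this is the subtracted `ln r / (2π)`. -/
theorem exists_tendsto_sum_weight (ha : 0 < a) (k : Plane) :
    ∃ l : ℝ, Tendsto (fun r => (area a)⁻¹ * ∑ m ∈ (finite_norm_le ha k r).toFinset, weight (ξ a m +
      k) -
      Real.log r / (2 * Real.pi)) atTop (𝓝 l) := by
  have hA := area_pos ha
  have hU : (⋃ r : ℝ, tileBall a k r) = Set.univ := by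
    rw [Set.eq_univ_iff_forall]
    exact fun y => Set.mem_iUnion.2 ⟨_, le_refl ‖ξ a (tileIndex a k y) + k‖⟩
  have h1 := tendsto_setIntegral_of_monotone (measurableSet_tileBall (a := a) k)
    (fun r r' h y hy => le_trans hy h) (by rw [hU]; exact (integrable_stepWeight_sub ha
      k).integrableOn)
  have h2 := (h1.add (tendsto_integral_weight_tileBall ha k)).const_mul ((4 * Real.pi ^ 2)⁻¹)
  refine ⟨_, h2.congr fun r => ?_⟩
  have hi := (integrable_stepWeight_sub ha k).integrableOn (s := tileBall a k r)
  have h3 : ∫ y in tileBall a k r, stepWeight a k y = (∫ y in tileBall a k r, (stepWeight a k y -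
    weight y)) +
      ∫ y in tileBall a k r, weight y := by
    rw [← integral_add hi (integrableOn_weight_tileBall ha k r)]
    simp
  rw [integral_stepWeight_tileBall ha] at h3
  have hp := Real.pi_ne_zero
  rw [← add_sub_assoc, ← h3]
  field_simp
  ring

theorem tendsto_toFinset_norm_le (ha : 0 < a) (k : Plane) :
    Tendsto (fun r => (finite_norm_le ha k r).toFinset) atTop atTop := by
  refine tendsto_atTop_finset_of_monotone (fun r r' h => ?_) fun m => ⟨‖ξ a m + k‖, by simp⟩
  exact Set.Finite.toFinset_subset_toFinset.2 fun m hm => le_trans hm h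

/-! ### Free resolvent coefficients and the renormalized Green's function at the origin -/

/-- `z` is none of the free energies `|ξ_m + k|²`. -/
def NonResonant (a : ℝ) (k : Plane) (z : ℂ) : Prop :=
  ∀ m, ((‖ξ a m + k‖ ^ 2 : ℝ) : ℂ) - z ≠ 0

theorem nonResonant_of_im_ne_zero (k : Plane) {z : ℂ} (hz : z.im ≠ 0) : NonResonant a k z := by
  intro m h
  apply hz
  rw [← sub_eq_zero.1 h, Complex.ofReal_im]

/-- The free resolvent coefficient `(|ξ_m + k|² - z)⁻¹`. -/
def res (a : ℝ) (k : Plane) (z : ℂ) (m : ℤ × ℤ) : ℂ := (((‖ξ a m + k‖ ^ 2 : ℝ) : ℂ) - z)⁻¹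

theorem conj_res (k : Plane) (z : ℂ) (m : ℤ × ℤ) : conj (res a k (conj z) m) = res a k z m := by
  rw [res, res, map_inv₀, map_sub, Complex.conj_conj, Complex.conj_ofReal]

theorem res_neg_one (k : Plane) (m : ℤ × ℤ) : res a k (-1) m = (weight (ξ a m + k) : ℝ) := by
  rw [res, weight]; push_cast; ring

theorem nonResonant_neg_one (k : Plane) : NonResonant a k (-1) := by
  intro m h
  have h2 : (1 + ‖ξ a m + k‖ ^ 2 : ℝ) = 0 := by
    have h3 : ((1 + ‖ξ a m + k‖ ^ 2 : ℝ) : ℂ) = 0 := by rw [← h]; push_cast; ring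
    exact_mod_cast h3
  have : 0 < (1 + ‖ξ a m + k‖ ^ 2 : ℝ) := by positivity
  exact this.ne' h2

theorem res_sub_res {k : Plane} {z w : ℂ} (hz : NonResonant a k z) (hw : NonResonant a k w)
    (m : ℤ × ℤ) : res a k z m - res a k w m = (z - w) * (res a k z m * res a k w m) := by
  have h1 := hz m
  have h2 := hw m
  rw [res, res]
  field_simp
  ring

/-- Once `1 + |ξ_m + k|²` exceeds `2(|z + 1| + 1)`, the triangle inequality gives a denominator of
at least half that size. Resonant `z` are allowed, since the bound is only asymptotic. -/
theorem res_isBigO (ha : 0 < a) (k : Plane) (z : ℂ) :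
    res a k z =O[cofinite] fun m => weight (ξ a m + k) := by
  refine Asymptotics.IsBigO.of_bound 2 ?_
  filter_upwards [(tendsto_weight_cofinite ha k).eventually_lt_const
    (show (0 : ℝ) < (2 * (‖z + 1‖ + 1))⁻¹ by positivity)] with m hm
  rw [weight] at hm ⊢
  have h1 : 0 < 1 + ‖ξ a m + k‖ ^ 2 := by positivity
  have h2 := (inv_lt_inv₀ h1 (by positivity)).1 hm
  have h3 : 1 + ‖ξ a m + k‖ ^ 2 ≤ ‖((‖ξ a m + k‖ ^ 2 : ℝ) : ℂ) - z‖ + ‖z + 1‖ := by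
    have e : ((1 + ‖ξ a m + k‖ ^ 2 : ℝ) : ℂ) = (((‖ξ a m + k‖ ^ 2 : ℝ) : ℂ) - z) + (z + 1) := by
      push_cast; ring
    have := norm_add_le (((‖ξ a m + k‖ ^ 2 : ℝ) : ℂ) - z) (z + 1)
    rwa [← e, Complex.norm_real, Real.norm_of_nonneg h1.le] at this
  rw [res, norm_inv, Real.norm_of_nonneg (by positivity), ← div_eq_mul_inv,
    inv_le_comm₀ (by linarith [norm_nonneg (z + 1)]) (by positivity), inv_div]
  linarith

theorem summable_res_mul_res (ha : 0 < a) (k : Plane) (z w : ℂ) :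
    Summable fun m => ‖res a k z m * res a k w m‖ := by
  refine summable_of_isBigO (summable_weight_sq ha k) ?_
  refine (((res_isBigO ha k z).mul (res_isBigO ha k w)).norm_left).congr_right fun m => ?_
  rw [sq]

theorem zero_mem_lattice (a : ℝ) : (0 : Plane) ∈ lattice a := ⟨0, 0, by simp⟩

theorem greenTrunc_zero (ha : 0 < a) (k : Plane) (z : ℂ) (r : ℝ) :
    greenTrunc a k z 0 r = (area a : ℂ)⁻¹ * ∑ m ∈ (finite_norm_le ha k r).toFinset, res a k z m -
      ((Real.log r / (2 * Real.pi) : ℝ) : ℂ) := by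
  rw [greenTrunc, if_pos (zero_mem_lattice a), finsum_mem_eq_finite_toFinset_sum _ (finite_norm_le
    ha k r)]
  simp only [one_div, res]

/-- Subtracting the coefficient at energy `-1`, which is the weight, leaves an absolutely summable
correction. The constant `l` is common to all `z`, so it cancels in differences of Green's values.
-/
theorem exists_tendsto_greenTrunc_zero (ha : 0 < a) {k : Plane} :
    ∃ l : ℂ, ∀ {z : ℂ}, NonResonant a k z → Tendsto (greenTrunc a k z 0) atTop
      (𝓝 (l + (area a : ℂ)⁻¹ * ((z + 1) * ∑' m, res a k z m * res a k (-1) m))) := by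
  obtain ⟨l, hl⟩ := exists_tendsto_sum_weight ha k
  refine ⟨l, fun {z} hz => ?_⟩
  have h1 := ((summable_res_mul_res ha k z (-1)).of_norm.hasSum.comp (tendsto_toFinset_norm_le ha
    k)).const_mul (z + 1)
  have h2 := (Complex.continuous_ofReal.tendsto l).comp hl
  refine (h2.add (h1.const_mul (area a : ℂ)⁻¹)).congr fun r => ?_
  rw [greenTrunc_zero ha]
  have e : ∀ m, res a k z m = (weight (ξ a m + k) : ℝ) + (z + 1) * (res a k z m * res a k (-1) m)
    := by
    intro m
    have := res_sub_res hz (nonResonant_neg_one k) m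
    rw [sub_neg_eq_add] at this
    rw [← this, res_neg_one]
    ring
  rw [Finset.sum_congr rfl fun m _ => e m, Finset.sum_add_distrib, ← Finset.mul_sum]
  simp only [Function.comp_apply]
  push_cast
  ring

theorem greenValue_zero_sub (ha : 0 < a) {k : Plane} {z w : ℂ} (hz : NonResonant a k z)
    (hw : NonResonant a k w) : greenValue a k z 0 - greenValue a k w 0 =
      (area a : ℂ)⁻¹ * ((z - w) * ∑' m, res a k z m * res a k w m) := by
  obtain ⟨l, hl⟩ := exists_tendsto_greenTrunc_zero ha (k := k)
  rw [greenValue, greenValue, (hl hz).limUnder_eq, (hl hw).limUnder_eq, add_sub_add_left_eq_sub,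
    ← mul_sub, ← tsum_mul_left, ← tsum_mul_left, ← tsum_mul_left, ← Summable.tsum_sub]
  · congr 2
    funext m
    have h1 := res_sub_res hz (nonResonant_neg_one k) m
    have h2 := res_sub_res hw (nonResonant_neg_one k) m
    have h3 := res_sub_res hz hw m
    rw [sub_neg_eq_add] at h1 h2
    rw [← h1, ← h2, ← h3]
    ring
  · exact (summable_res_mul_res ha k z (-1)).of_norm.mul_left _
  · exact (summable_res_mul_res ha k w (-1)).of_norm.mul_left _

/-- The coefficients at `i` and `-i` are complex conjugates, so the difference is `2i / area` times
a positive sum of squares. -/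
theorem greenValue_I_ne (ha : 0 < a) (k : Plane) :
    greenValue a k Complex.I 0 ≠ greenValue a k (-Complex.I) 0 := by
  have hA : (area a : ℂ) ≠ 0 := by exact_mod_cast (area_pos ha).ne'
  have hI : NonResonant a k Complex.I := nonResonant_of_im_ne_zero k (by simp)
  have hI' : NonResonant a k (-Complex.I) := nonResonant_of_im_ne_zero k (by simp)
  rw [← sub_ne_zero, greenValue_zero_sub ha hI hI']
  have e : ∀ m, res a k Complex.I m * res a k (-Complex.I) m = ((‖res a k Complex.I m‖ ^ 2 : ℝ) :
    ℂ) := by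
    intro m
    have := conj_res (a := a) k (-Complex.I) m
    rw [map_neg, Complex.conj_I, neg_neg] at this
    rw [← this, Complex.mul_conj, Complex.normSq_eq_norm_sq]
  have hs : Summable fun m => ‖res a k Complex.I m‖ ^ 2 := by
    simpa [sq] using summable_res_mul_res ha k Complex.I Complex.I
  simp only [e]
  rw [← Complex.ofReal_tsum]
  have hpos : 0 < ∑' m, ‖res a k Complex.I m‖ ^ 2 :=
    hs.tsum_pos (fun m => sq_nonneg _) 0 (by
      have := inv_ne_zero (hI 0)
      rw [res]; positivity)
  refine mul_ne_zero (inv_ne_zero hA) (mul_ne_zero ?_ ?_)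
  · rw [sub_neg_eq_add, ← two_mul]; simp
  · exact_mod_cast hpos.ne'

/-! ### The free Laplacian and its resolvent in Fourier coefficients -/

theorem freeLaplacian_graph (ha : 0 < a) (k : Plane) : (freeLaplacian a k).graph = freeGraph a k :=
    by
  refine Submodule.toLinearPMap_graph_eq _ fun p hp h0 => ?_
  refine eq_zero_of_inner_planeWave ha k _ fun m => ?_
  rw [hp m, h0, inner_zero_right, mul_zero]

theorem coef_sub_smul (k : Plane) (f g : L2 a) (z : ℂ) (m : ℤ × ℤ) :
    coef k (f - z • g) m = coef k f m - z * coef k g m := by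
  rw [coef, inner_sub_right, inner_smul_right]

theorem norm_res_le (ha : 0 < a) (k : Plane) (z : ℂ) : ∃ C, ∀ m, ‖res a k z m‖ ^ 2 ≤ C := by
  have hs : Summable fun m => ‖res a k z m‖ ^ 2 := by
    simpa [sq] using summable_res_mul_res ha k z z
  exact ⟨_, fun m => hs.le_tsum m fun _ _ => sq_nonneg _⟩

theorem summable_norm_coef_sq (ha : 0 < a) (k : Plane) (f : L2 a) :
    Summable fun m => ‖coef k f m‖ ^ 2 :=
  (summable_mul_left_iff (inv_ne_zero (area_pos ha).ne')).1 (hasSum_norm_coef_sq ha k f).summable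

theorem tendsto_coef_cofinite (ha : 0 < a) (k : Plane) (f : L2 a) :
    Tendsto (coef k f) cofinite (𝓝 0) := by
  have h := (summable_norm_coef_sq ha k f).tendsto_cofinite_zero.sqrt
  rw [tendsto_zero_iff_norm_tendsto_zero]
  simpa [Real.sqrt_sq (norm_nonneg _)] using h

/-- A bounded diagonal multiplier. At resonant indices the inverse is `0` by convention, so the map
exists for all `z`, though it inverts the Laplacian only for nonresonant `z`. -/
theorem exists_free_resolvent (ha : 0 < a) (k : Plane) (z : ℂ) :
    ∃ S : L2 a →L[ℂ] L2 a, ∀ f m, coef k (S f) m = res a k z m * coef k f m := by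
  obtain ⟨C, hC⟩ := norm_res_le ha k z
  have hC0 : 0 ≤ C := (sq_nonneg _).trans (hC 0)
  have hb : ∀ (f : L2 a) m, ‖res a k z m * coef k f m‖ ^ 2 ≤ C * ‖coef k f m‖ ^ 2 := by
    intro f m
    rw [norm_mul, mul_pow]
    exact mul_le_mul_of_nonneg_right (hC m) (sq_nonneg _)
  have hex : ∀ f : L2 a, ∃ g : L2 a, ∀ m, coef k g m = res a k z m * coef k f m := by
    intro f
    obtain ⟨g, -, hg⟩ := exists_coef_eq ha k (fun m => res a k z m * coef k f m)
      (((summable_norm_coef_sq ha k f).mul_left C).of_nonneg_of_le (fun _ => sq_nonneg _) (hb f))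
    exact ⟨g, hg⟩
  choose S hS using hex
  refine ⟨LinearMap.mkContinuous ⟨⟨S, fun f g => ext_coef ha k fun m => ?_⟩, fun c f => ext_coef ha
    k fun m => ?_⟩ (√C)
    fun f => ?_, hS⟩
  · rw [hS, coef, coef, inner_add_right, inner_add_right, mul_add]
    exact congrArg₂ (· + ·) (hS f m).symm (hS g m).symm
  · simp only [RingHom.id_apply]
    rw [hS, coef, coef, inner_smul_right, inner_smul_right, mul_left_comm]
    exact congrArg (c * ·) (hS f m).symm
  · have hA := area_pos ha
    refine le_of_sq_le_sq ?_ (by positivity)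
    rw [mul_pow, Real.sq_sqrt hC0]
    refine hasSum_le (fun m => ?_) (hasSum_norm_coef_sq ha k (S f)) ((hasSum_norm_coef_sq ha k
      f).mul_left C)
    rw [mul_left_comm, hS]
    exact mul_le_mul_of_nonneg_left (hb f m) (inv_pos.2 hA).le

/-- Removes the domain subtype: a solution of the coefficient equations lies automatically in the
domain. The predicate `P` carries along whatever else is required of the solution. -/
theorem exists_freeLaplacian_sub_eq_iff (ha : 0 < a) (k : Plane) (z : ℂ) (h : L2 a) (P : L2 a →
    Prop) :
    (∃ φ : (freeLaplacian a k).domain, freeLaplacian a k φ - z • (φ : L2 a) = h ∧ P φ) ↔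
      ∃ φ : L2 a, (∀ m, (((‖ξ a m + k‖ ^ 2 : ℝ) : ℂ) - z) * coef k φ m = coef k h m) ∧ P φ := by
  constructor
  · rintro ⟨φ, h1, h2⟩
    refine ⟨φ, fun m => ?_, h2⟩
    have hg := (freeLaplacian a k).mem_graph φ
    rw [freeLaplacian_graph ha] at hg
    rw [← h1, coef_sub_smul, sub_mul]
    exact congrArg (· - _) (hg m).symm
  · rintro ⟨φ, h1, h2⟩
    have hg : (φ, h + z • φ) ∈ (freeLaplacian a k).graph := by
      rw [freeLaplacian_graph ha]
      intro m
      have := h1 m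
      rw [inner_add_right, inner_smul_right]
      rw [sub_mul, sub_eq_iff_eq_add] at this
      exact this.symm
    obtain ⟨φ', e1, e2⟩ := (LinearPMap.mem_graph_iff _).1 hg
    simp only at e1 e2
    refine ⟨φ', ?_, by rwa [e1]⟩
    rw [e2, e1, add_sub_cancel_right]

theorem notMem_opSpectrum_freeLaplacian_iff (ha : 0 < a) (k : Plane) (z : ℂ) :
    z ∉ opSpectrum (freeLaplacian a k) ↔ NonResonant a k z := by
  have hdef : z ∉ opSpectrum (freeLaplacian a k) ↔ InResolventSet (freeLaplacian a k) z := by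
    simp [opSpectrum]
  rw [hdef]
  constructor
  · rintro ⟨S, -, hS⟩ m hm
    -- At a resonance the plane wave lies in the kernel, and a left inverse would send `0` to it.
    obtain ⟨φ, h1, h2⟩ := (exists_freeLaplacian_sub_eq_iff ha k z 0 (fun φ => φ = planeWave a k
      m)).2
      ⟨planeWave a k m, fun n => by
        rw [coef, coef, inner_planeWave_planeWave ha, inner_zero_right]
        split_ifs with h
        · rw [h, hm, zero_mul]
        · rw [mul_zero], rfl⟩
    have h3 := hS φ
    rw [h1, map_zero, h2] at h3
    have h4 := inner_planeWave_planeWave ha k m m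
    rw [← h3, inner_zero_right, if_pos rfl] at h4
    exact (area_pos ha).ne (by exact_mod_cast h4)
  · intro hz
    obtain ⟨S, hS⟩ := exists_free_resolvent ha k z
    refine ⟨S, fun f => ?_, fun ψ => ?_⟩
    · obtain ⟨φ, h1, h2⟩ := (exists_freeLaplacian_sub_eq_iff ha k z f (fun φ => φ = S f)).2
        ⟨S f, fun m => by rw [hS, res, mul_inv_cancel_left₀ (hz m)], rfl⟩
      refine ⟨h2 ▸ φ.2, ?_⟩
      have e : (⟨S f, h2 ▸ φ.2⟩ : (freeLaplacian a k).domain) = φ := Subtype.ext h2.symm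
      rw [e, ← h2, h1]
    · obtain ⟨φ, h1, h2⟩ := (exists_freeLaplacian_sub_eq_iff ha k z _ (fun φ => φ = ψ)).1 ⟨ψ, rfl,
        rfl⟩
      refine ext_coef ha k fun m => ?_
      rw [hS, ← h1, h2, res, inv_mul_cancel_left₀ (hz m)]

/-! ### Point sources and decoupled scatterers -/

/-- The coefficients of the unnormalized point source at `y`. -/
abbrev src (a : ℝ) (k y : Plane) (m : ℤ × ℤ) : ℂ := planeWaveFun a k m (-y)

theorem norm_src (k y : Plane) (m : ℤ × ℤ) : ‖src a k y m‖ = 1 := by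
  rw [src, planeWaveFun, mul_comm, Complex.norm_exp_ofReal_mul_I]

theorem coef_green (ha : 0 < a) (k : Plane) (z : ℂ) (y : Plane) (m : ℤ × ℤ) :
    coef k (green a k z y) m = res a k z m * src a k y m := by
  obtain ⟨f, h1, h2⟩ := exists_coef_eq ha k (fun m => res a k z m * src a k y m) (by
    simpa [norm_mul, norm_src, sq] using summable_res_mul_res ha k z z)
  have e : green a k z y = f := by
    rw [← h1.tsum_eq, green]
    refine tsum_congr fun n => ?_
    rw [res, src]
    congr 1
    ring
  rw [e, h2]

theorem hasSum_inner_green (ha : 0 < a) (k : Plane) (z : ℂ) (y : Plane) (f : L2 a) :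
    HasSum (fun m => (area a : ℂ)⁻¹ * (conj (src a k y m) * (res a k z m * coef k f m)))
      (inner ℂ (green a k (conj z) y) f) := by
  refine (hasSum_coef ha k (green a k (conj z) y) f).congr_fun fun m => ?_
  rw [coef_green ha, map_mul, conj_res]
  ring

section Sites

variable {ι : Type*} [Fintype ι]

theorem coef_zero (k : Plane) (m : ℤ × ℤ) : coef k (0 : L2 a) m = 0 := inner_zero_right _

theorem coef_add (k : Plane) (f g : L2 a) (m : ℤ × ℤ) : coef k (f + g) m = coef k f m + coef k g m
    :=
  inner_add_right _ _ _

theorem coef_sub (k : Plane) (f g : L2 a) (m : ℤ × ℤ) : coef k (f - g) m = coef k f m - coef k g m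
    :=
  inner_sub_right _ _ _

theorem coef_smul (k : Plane) (c : ℂ) (f : L2 a) (m : ℤ × ℤ) : coef k (c • f) m = c * coef k f m :=
  inner_smul_right _ _ _

theorem coef_sum (k : Plane) (f : ι → L2 a) (m : ℤ × ℤ) : coef k (∑ j, f j) m = ∑ j, coef k (f j) m
    :=
  inner_sum _ _ _

theorem summable_src_mul_res (ha : 0 < a) (k x x' : Plane) (z w : ℂ) :
    Summable fun m => conj (src a k x m) * src a k x' m * (res a k z m * res a k w m) := by
  refine ((summable_res_mul_res ha k z w).congr fun m => ?_).of_norm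
  rw [norm_mul (conj _ * _), norm_mul (conj _), RCLike.norm_conj, norm_src, norm_src, one_mul,
    one_mul]

theorem conj_src_mul_src (k x : Plane) (m : ℤ × ℤ) : conj (src a k x m) * src a k x m = 1 := by
  rw [mul_comm]; exact planeWaveFun_mul_conj a k (-x) m

theorem coef_sum_green (ha : 0 < a) (k : Plane) (y : ι → Plane) (z : ℂ) (c : ι → ℂ) (m : ℤ × ℤ) :
    coef k (∑ j, c j • green a k z (y j)) m = res a k z m * ∑ j, c j * src a k (y j) m := by
  rw [coef_sum, Finset.mul_sum]
  refine Finset.sum_congr rfl fun j _ => ?_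
  rw [coef_smul, coef_green ha]
  ring

variable [DecidableEq ι]

/-- Sites that do not interact: the matrix `Γ` is the scalar matrix `q`, and the point sources at
distinct sites are orthogonal to each other in every resolvent. -/
structure IsDecoupled (a : ℝ) (k : Plane) (α : ι → ℝ) (y : ι → Plane) (q : ℂ → ℂ) : Prop where
  gamma_eq : ∀ z, NonResonant a k z → gammaMatrix a k α y z = Matrix.scalar ι (q z)
  sub_eq : ∀ z w, NonResonant a k z → NonResonant a k w →
    q w - q z = (area a : ℂ)⁻¹ * ((z - w) * ∑' m, res a k z m * res a k w m)
  orthogonal : ∀ i j, i ≠ j → ∀ z w,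
    ∑' m, conj (src a k (y i) m) * src a k (y j) m * (res a k z m * res a k w m) = 0
  independent : ∀ c : ι → ℂ,
    Tendsto (fun m => ∑ j, c j * src a k (y j) m) cofinite (𝓝 0) → c = 0
  exists_ne_zero : ∃ w, NonResonant a k w ∧ q w ≠ 0

/-- The pair `(ψ, η)` satisfies `-Δ ψ = η + ∑ c_j δ_{y_j}` with charges `c_j` given by the boundary
condition at the sites, evaluated at the energy `z`. -/
def BoundaryRel (a : ℝ) (k : Plane) (y : ι → Plane) (q : ℂ → ℂ) (z : ℂ) (p : L2 a × L2 a) : Prop :=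
  ∃ c : ι → ℂ, (∀ m, ((‖ξ a m + k‖ ^ 2 : ℝ) : ℂ) * coef k p.1 m =
      coef k p.2 m + ∑ j, c j * src a k (y j) m) ∧
    ∀ j, q z * c j = inner ℂ (green a k (conj z) (y j)) (p.2 - z • p.1)

section Decoupled

variable {k : Plane} {α : ι → ℝ} {y : ι → Plane} {q : ℂ → ℂ}

theorem IsDecoupled.hasSum_src (H : IsDecoupled a k α y q) (ha : 0 < a) (i j : ι) (z w : ℂ) :
    HasSum (fun m => conj (src a k (y i) m) * src a k (y j) m * (res a k z m * res a k w m))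
      (if i = j then ∑' m, res a k z m * res a k w m else 0) := by
  split_ifs with h
  · subst h
    simp only [conj_src_mul_src, one_mul]
    exact (summable_res_mul_res ha k z w).of_norm.hasSum
  · rw [← H.orthogonal i j h z w]
    exact (summable_src_mul_res ha k _ _ z w).hasSum

/-- The same charges work at every energy. The right-hand sides at `z` and `w` differ, by the
resolvent identity, by a sum over sites in which orthogonality keeps only site `j`; what remains is
`(q(z) - q(w)) c_j`. -/
theorem IsDecoupled.boundaryRel_of (H : IsDecoupled a k α y q) (ha : 0 < a) {z w : ℂ}
    (hz : NonResonant a k z) (hw : NonResonant a k w) {p : L2 a × L2 a}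
    (hp : BoundaryRel a k y q z p) : BoundaryRel a k y q w p := by
  obtain ⟨c, h1, h2⟩ := hp
  refine ⟨c, h1, fun j => ?_⟩
  have h3 := (hasSum_inner_green ha k z (y j) (p.2 - z • p.1)).sub
    (hasSum_inner_green ha k w (y j) (p.2 - w • p.1))
  have h4 : HasSum (fun m => (area a : ℂ)⁻¹ * ((w - z) * ∑ i, c i * (conj (src a k (y j) m) * src a
    k (y i) m *
      (res a k z m * res a k w m)))) ((area a : ℂ)⁻¹ * ((w - z) * ∑ i, c i *
        (if j = i then ∑' m, res a k z m * res a k w m else 0))) :=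
    ((hasSum_sum (s := Finset.univ) fun i _ => (H.hasSum_src ha j i z w).mul_left (c i)).mul_left
      (w - z)).mul_left _
  -- The equation for `ψ` says that `η - uψ` is `(|ξ_m + k|² - u) ψ` minus the sources; the first
  -- term, once resolved, does not depend on `u` and cancels in the difference.
  have e : ∀ (u : ℂ), NonResonant a k u → ∀ m, res a k u m * coef k (p.2 - u • p.1) m =
      coef k p.1 m - res a k u m * ∑ i, c i * src a k (y i) m := by
    intro u hu m
    rw [coef_sub_smul, eq_sub_iff_add_eq, ← mul_add, sub_add_eq_add_sub, ← h1, ← sub_mul, res,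
      inv_mul_cancel_left₀ (hu m)]
  have h5 := h3.unique (h4.congr_fun fun m => ?_)
  rotate_left
  · rw [e z hz, e w hw, ← mul_sub, ← mul_sub, sub_sub_sub_cancel_left, ← sub_mul, res_sub_res hw hz]
    simp only [Finset.mul_sum]
    refine Finset.sum_congr rfl fun i _ => ?_
    ring
  simp only [mul_ite, mul_zero, Finset.sum_ite_eq, Finset.mem_univ, if_true] at h5
  rw [← h2, sub_eq_iff_eq_add] at h5
  have h6 := H.sub_eq w z hw hz
  simp only [mul_comm (res a k w _)] at h6
  have h7 : q z * c j - q w * c j = (area a : ℂ)⁻¹ * ((w - z) * (c j * ∑' m, res a k z m * res a k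
    w m)) := by
    rw [← sub_mul, h6]; ring
  rw [h5, sub_eq_iff_eq_add] at h7
  linear_combination -h7

theorem IsDecoupled.isUnit_det (H : IsDecoupled a k α y q) {z : ℂ} (hz : NonResonant a k z)
    (hq : q z ≠ 0) : IsUnit (gammaMatrix a k α y z).det := by
  rw [H.gamma_eq z hz, Matrix.scalar_apply, Matrix.det_diagonal, Finset.prod_const]
  exact (pow_ne_zero _ hq).isUnit

theorem IsDecoupled.ne_zero_of_isUnit_det [Nonempty ι] (H : IsDecoupled a k α y q) {z : ℂ} (hz :
    NonResonant a k z)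
    (h : IsUnit (gammaMatrix a k α y z).det) : q z ≠ 0 := by
  rintro hq
  rw [H.gamma_eq z hz, hq] at h
  simp at h

theorem IsDecoupled.kreinTerm_eq (H : IsDecoupled a k α y q) {z : ℂ} (hz : NonResonant a k z)
    (hq : q z ≠ 0) (f : L2 a) : kreinTerm a k α y z f =
      ∑ j, ((q z)⁻¹ * inner ℂ (green a k (conj z) (y j)) f) • green a k z (y j) := by
  have hinv : (gammaMatrix a k α y z)⁻¹ = Matrix.scalar ι (q z)⁻¹ := by
    refine Matrix.inv_eq_right_inv ?_
    rw [H.gamma_eq z hz, ← map_mul, mul_inv_cancel₀ hq, map_one]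
  rw [kreinTerm, hinv]
  refine Finset.sum_congr rfl fun j _ => ?_
  rw [Finset.sum_eq_single j]
  · rw [Matrix.scalar_apply, Matrix.diagonal_apply_eq]
  · intro i _ hij
    rw [Matrix.scalar_apply, Matrix.diagonal_apply_ne _ hij.symm, zero_mul, zero_smul]
  · simp

/-- With `q(z) ≠ 0` the boundary condition determines the charges, and they are the coefficients in
Krein's formula; `φ` is `ψ` with its singular part removed. -/
theorem IsDecoupled.krein_iff (H : IsDecoupled a k α y q) (ha : 0 < a) {z : ℂ}
    (hz : NonResonant a k z) (hq : q z ≠ 0) (p : L2 a × L2 a) :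
    (∃ φ : (freeLaplacian a k).domain, freeLaplacian a k φ - z • (φ : L2 a) = p.2 - z • p.1 ∧
      p.1 = (φ : L2 a) + kreinTerm a k α y z (p.2 - z • p.1)) ↔ BoundaryRel a k y q z p := by
  rw [exists_freeLaplacian_sub_eq_iff ha k z (p.2 - z • p.1)
    (fun φ => p.1 = φ + kreinTerm a k α y z (p.2 - z • p.1)), H.kreinTerm_eq hz hq]
  constructor
  · rintro ⟨φ, h1, h2⟩
    refine ⟨fun j => (q z)⁻¹ * inner ℂ (green a k (conj z) (y j)) (p.2 - z • p.1), fun m => ?_,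
      fun j => mul_inv_cancel_left₀ hq _⟩
    have h3 := congrArg (fun f => coef k f m) h2
    rw [coef_add, coef_sum_green ha k y z
      (fun j => (q z)⁻¹ * inner ℂ (green a k (conj z) (y j)) (p.2 - z • p.1))] at h3
    have h5 := h1 m
    rw [coef_sub_smul] at h5
    have h6 := congrArg ((((‖ξ a m + k‖ ^ 2 : ℝ) : ℂ) - z) * ·) h3
    rw [mul_add, res, mul_inv_cancel_left₀ (hz m)] at h6
    linear_combination h6 + h5
  · rintro ⟨c, h1, h2⟩
    have hc : ∀ j, (q z)⁻¹ * inner ℂ (green a k (conj z) (y j)) (p.2 - z • p.1) = c j := by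
      intro j
      rw [← h2, inv_mul_cancel_left₀ hq]
    simp only [hc]
    refine ⟨p.1 - ∑ j, c j • green a k z (y j), fun m => ?_, by abel⟩
    rw [coef_sub, coef_sum_green ha k y z c m, coef_sub_smul, res, mul_sub, mul_inv_cancel_left₀
      (hz m)]
    linear_combination h1 m

/-- The defining condition says nothing at zeros of `q`. It is read off at one energy `w` with `q(w)
≠ 0` and then transported to `z`, which may itself be a zero. -/
theorem IsDecoupled.mem_scattererGraph_iff [Nonempty ι] (H : IsDecoupled a k α y q) (ha : 0 < a) {z
    : ℂ}
    (hz : NonResonant a k z) (p : L2 a × L2 a) :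
    p ∈ scattererGraph a k α y ↔ BoundaryRel a k y q z p := by
  constructor
  · intro hp
    obtain ⟨w, hw, hqw⟩ := H.exists_ne_zero
    have h1 := hp w ((notMem_opSpectrum_freeLaplacian_iff ha k w).2 hw) (H.isUnit_det hw hqw)
    exact H.boundaryRel_of ha hw hz ((H.krein_iff ha hw hqw p).1 h1)
  · intro hp w hw hdet
    have hw' := (notMem_opSpectrum_freeLaplacian_iff ha k w).1 hw
    exact (H.krein_iff ha hw' (H.ne_zero_of_isUnit_det hw' hdet) p).2 (H.boundaryRel_of ha hz hw'
      hp)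

/-- The graph is single-valued because no nonzero combination of point sources is square integrable:
for `ψ = 0` the sources have the coefficients of `-η`, which tend to zero. -/
theorem IsDecoupled.scatterer_graph [Nonempty ι] (H : IsDecoupled a k α y q) (ha : 0 < a) :
    (scatterer a k α y).graph = scattererGraph a k α y := by
  refine Submodule.toLinearPMap_graph_eq _ fun p hp h0 => ?_
  obtain ⟨w, hw, -⟩ := H.exists_ne_zero
  obtain ⟨c, h1, -⟩ := (H.mem_scattererGraph_iff ha hw p).1 hp
  have h2 : ∀ m, ∑ j, c j * src a k (y j) m = - coef k p.2 m := by
    intro m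
    have := h1 m
    rw [h0, coef_zero, mul_zero] at this
    linear_combination -this
  have hc : c = 0 := by
    refine H.independent c ?_
    simp only [h2]
    simpa using (tendsto_coef_cofinite ha k p.2).neg
  refine eq_zero_of_inner_planeWave ha k _ fun m => ?_
  have := h2 m
  simpa [hc] using this

/-- For `η = zψ` the right side of the boundary condition is zero, and `q(z) = 0` kills the left
side, so the charges are unconstrained. -/
theorem IsDecoupled.mem_eigenspace_iff [Nonempty ι] (H : IsDecoupled a k α y q) (ha : 0 < a) {z : ℂ}
    (hz : NonResonant a k z) (hq : q z = 0) (ψ : L2 a) :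
    ψ ∈ eigenspace (scatterer a k α y) z ↔ ∃ c : ι → ℂ, ∑ j, c j • green a k z (y j) = ψ := by
  have h0 : ψ ∈ eigenspace (scatterer a k α y) z ↔ (ψ, z • ψ) ∈ scattererGraph a k α y := by
    rw [← H.scatterer_graph ha]; rfl
  rw [h0, H.mem_scattererGraph_iff ha hz]
  refine exists_congr fun c => ?_
  simp only [sub_self, inner_zero_right, hq, zero_mul, implies_true, and_true]
  have hiff : ∀ m, (((‖ξ a m + k‖ ^ 2 : ℝ) : ℂ) * coef k ψ m = coef k (z • ψ) m + ∑ j, c j * src a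
    k (y j) m) ↔
      coef k (∑ j, c j • green a k z (y j)) m = coef k ψ m := by
    intro m
    rw [coef_sum_green ha, res, inv_mul_eq_iff_eq_mul₀ (hz m), coef_smul, sub_mul]
    exact ⟨fun h => by linear_combination -h, fun h => by linear_combination -h⟩
  exact ⟨fun h => ext_coef ha k fun m => (hiff m).1 (h m), fun h m => (hiff m).2 (by rw [h])⟩

theorem IsDecoupled.mult_eq [Nonempty ι] (H : IsDecoupled a k α y q) (ha : 0 < a) {z : ℂ}
    (hz : NonResonant a k z) (hq : q z = 0) :
    mult z (scatterer a k α y) = Fintype.card ι := by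
  have e : eigenspace (scatterer a k α y) z =
      LinearMap.range (Fintype.linearCombination ℂ fun j => green a k z (y j)) := by
    ext ψ
    rw [H.mem_eigenspace_iff ha hz hq, LinearMap.mem_range]
    rfl
  rw [mult, e, LinearMap.finrank_range_of_inj, Module.finrank_fintype_fun_eq_card]
  rw [← LinearMap.ker_eq_bot, LinearMap.ker_eq_bot']
  intro c hc
  refine H.independent c ?_
  have h : ∀ m, ∑ j, c j * src a k (y j) m = 0 := by
    intro m
    have h1 := coef_sum_green ha k y z c m
    have h2 : ∑ j, c j • green a k z (y j) = 0 := hc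
    rw [h2, coef_zero] at h1
    exact (mul_eq_zero.1 h1.symm).resolve_left (inv_ne_zero (hz m))
  simp only [h, tendsto_const_nhds]

theorem IsDecoupled.mem_opSpectrum_iff [Nonempty ι] (H : IsDecoupled a k α y q) (ha : 0 < a) {z : ℂ}
    (hz : NonResonant a k z) : z ∈ opSpectrum (scatterer a k α y) ↔ q z = 0 := by
  constructor
  · intro h
    by_contra hq
    apply h
    obtain ⟨S, hS⟩ := exists_free_resolvent ha k z
    -- Krein's resolvent formula with the scalar matrix `Γ⁻¹ = q(z)⁻¹ I`.
    set R : L2 a →L[ℂ] L2 a := S + ∑ j, ((q z)⁻¹ • innerSL ℂ (green a k (conj z) (y j))).smulRight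
      (green a k z (y j)) with hR
    have hR' : ∀ f, R f = S f + ∑ j, ((q z)⁻¹ * inner ℂ (green a k (conj z) (y j)) f) • green a k z
      (y j) := by
      intro f
      simp [hR]
    have hcoef : ∀ f m, coef k (R f) m = res a k z m * (coef k f m +
        ∑ j, ((q z)⁻¹ * inner ℂ (green a k (conj z) (y j)) f) * src a k (y j) m) := by
      intro f m
      rw [hR', coef_add, mul_add]
      exact congrArg₂ (· + ·) (hS f m) (coef_sum_green ha k y z _ m)
    refine ⟨R, fun f => ?_, fun ψ => ?_⟩
    · have hg : (R f, f + z • R f) ∈ (scatterer a k α y).graph := by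
        rw [H.scatterer_graph ha, H.mem_scattererGraph_iff ha hz]
        refine ⟨fun j => (q z)⁻¹ * inner ℂ (green a k (conj z) (y j)) f, fun m => ?_, fun j => ?_⟩
        · have h1 := hcoef f m
          rw [res, eq_inv_mul_iff_mul_eq₀ (hz m), sub_mul, sub_eq_iff_eq_add] at h1
          rw [h1, coef_add, coef_smul]
          ring
        · simp [mul_inv_cancel_left₀ hq]
      obtain ⟨ψ, e1, e2⟩ := (LinearPMap.mem_graph_iff _).1 hg
      simp only at e1 e2
      refine ⟨e1 ▸ ψ.2, ?_⟩
      have e : (⟨R f, e1 ▸ ψ.2⟩ : (scatterer a k α y).domain) = ψ := Subtype.ext e1.symm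
      rw [e, e2, add_sub_cancel_right]
    · have hg := (scatterer a k α y).mem_graph ψ
      rw [H.scatterer_graph ha, H.mem_scattererGraph_iff ha hz] at hg
      obtain ⟨c, h1, h2⟩ := hg
      refine ext_coef ha k fun m => ?_
      rw [hcoef, res, inv_mul_eq_iff_eq_mul₀ (hz m), coef_sub_smul, sub_mul, h1]
      simp only [← h2, inv_mul_cancel_left₀ hq]
      ring
  · rintro hq ⟨S, -, hS⟩
    obtain ⟨i⟩ := ‹Nonempty ι›
    have hi : Nonempty ι := ⟨i⟩
    have h1 : green a k z (y i) ∈ eigenspace (scatterer a k α y) z :=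
      (H.mem_eigenspace_iff ha hz hq _).2 ⟨Pi.single i 1, by simp [Pi.single_apply]⟩
    obtain ⟨ψ, e1, e2⟩ := (LinearPMap.mem_graph_iff _).1 (show (green a k z (y i), z • green a k z
      (y i)) ∈ (scatterer a k α y).graph from h1)
    simp only at e1 e2
    have h2 := hS ψ
    rw [e2, e1, sub_self, map_zero] at h2
    -- The eigenvector `g_z(· - y_i)` is nonzero: its coefficient at index `0` is a nonzero
    -- resolvent factor times a unimodular number.
    have h3 := coef_green ha k z (y i) 0
    rw [← h2, coef_zero, eq_comm, mul_eq_zero] at h3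
    rcases h3 with h3 | h3
    · exact inv_ne_zero (hz 0) h3
    · have := norm_src (a := a) k (y i) 0
      rw [h3, norm_zero] at this
      exact zero_ne_one this

end Decoupled

end Sites

/-! ### Threefold rotation symmetry at the Dirac point -/

/-- The action on the indices `m` of the rotation by `2π/3` of the shifted dual lattice
`K + ξ_m`. -/
def diracRotation : ℤ × ℤ ≃ ℤ × ℤ where
  toFun m := (-m.2 - 1, m.1 - m.2)
  invFun m := (m.2 - m.1 - 1, -m.1 - 1)
  left_inv m := Prod.ext (by dsimp only; ring) (by dsimp only; ring)
  right_inv m := Prod.ext (by dsimp only; ring) (by dsimp only; ring)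

theorem ξ_add_diracPoint (a : ℝ) (m : ℤ × ℤ) : ξ a m + diracPoint a =
    spanMap (k₁ a) (k₂ a) ![(m.1 : ℝ) + 2 / 3, (m.2 : ℝ) + 1 / 3] := by
  simp only [ξ, diracPoint, spanMap, Matrix.cons_val_zero, Matrix.cons_val_one, add_smul]
  abel

theorem norm_sq_spanMap_dual (a s t : ℝ) : ‖spanMap (k₁ a) (k₂ a) ![s, t]‖ ^ 2 =
    (4 * Real.pi / (a * √3)) ^ 2 * (s ^ 2 - s * t + t ^ 2) := by
  have h3 : √3 ^ 2 = 3 := Real.sq_sqrt (by norm_num)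
  rw [← real_inner_self_eq_norm_sq, inner_plane]
  simp only [spanMap, k₁, k₂, Matrix.cons_val_zero, Matrix.cons_val_one, PiLp.add_apply,
    PiLp.smul_apply, smul_eq_mul]
  linear_combination ((4 * Real.pi / (a * √3)) ^ 2 * ((s - t) ^ 2 / 4)) * h3

/-- In the coordinates `s = m₁ + 2/3`, `t = m₂ + 1/3` the rotation is `(s, t) ↦ (-t, s - t)`, which
preserves `s² - st + t²`; the shifts by `K` are what make it map integer indices to integer indices.
-/
theorem norm_diracRotation (a : ℝ) (m : ℤ × ℤ) :
    ‖ξ a (diracRotation m) + diracPoint a‖ = ‖ξ a m + diracPoint a‖ := by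
  rw [← sq_eq_sq₀ (norm_nonneg _) (norm_nonneg _), ξ_add_diracPoint, ξ_add_diracPoint,
    norm_sq_spanMap_dual, norm_sq_spanMap_dual]
  simp only [diracRotation, Equiv.coe_fn_mk]
  push_cast
  ring

theorem res_diracRotation (z : ℂ) (m : ℤ × ℤ) :
    res a (diracPoint a) z (diracRotation m) = res a (diracPoint a) z m := by
  rw [res, res, norm_diracRotation]

theorem inner_ξ_add_diracPoint_x₀ (ha : 0 < a) (m : ℤ × ℤ) :
    inner ℝ (ξ a m + diracPoint a) (x₀ a) = 4 * Real.pi / 3 * (m.1 + m.2 + 1) := by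
  have h0 : √3 ≠ 0 := by positivity
  rw [ξ_add_diracPoint, inner_plane]
  simp only [spanMap, k₁, k₂, x₀, v₁, v₂, Matrix.cons_val_zero, Matrix.cons_val_one, PiLp.add_apply,
    PiLp.smul_apply, smul_eq_mul]
  field_simp
  ring

/-- The phase that a plane wave at `x₀` acquires under the rotation of the dual lattice. -/
def rotationPhase : ℂ := Complex.exp (-(2 * Real.pi * Complex.I * (2 / 3)))

theorem rotationPhase_ne_one : rotationPhase ≠ 1 := by
  intro h
  obtain ⟨n, hn⟩ := Complex.exp_eq_one_iff.1 h
  have h2 : (2 * Real.pi * Complex.I : ℂ) ≠ 0 := Complex.two_pi_I_ne_zero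
  have h3 : (-(2 / 3) : ℂ) = n := by
    apply mul_right_cancel₀ h2
    rw [← hn]; ring
  have h4 : (3 * n : ℂ) = -2 := by rw [← h3]; ring
  have h5 : 3 * n = -2 := by exact_mod_cast h4
  omega

theorem planeWaveFun_neg (a : ℝ) (k x : Plane) (m : ℤ × ℤ) :
    planeWaveFun a k m (-x) = conj (planeWaveFun a k m x) := by
  rw [planeWaveFun, planeWaveFun, ← Complex.exp_conj, map_mul, Complex.conj_I, Complex.conj_ofReal,
    inner_neg_right]
  congr 1
  push_cast
  ring

theorem planeWaveFun_diracRotation (ha : 0 < a) (m : ℤ × ℤ) :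
    planeWaveFun a (diracPoint a) (diracRotation m) (x₀ a) =
      rotationPhase * planeWaveFun a (diracPoint a) m (x₀ a) := by
  -- The rotation changes `m₁ + m₂ + 1` by `-3m₂ - 1`, so the phase changes by `-4πm₂ - 4π/3`; the
  -- first term is a full period.
  have h : Complex.exp (((-2 * m.2 : ℤ) : ℂ) * (2 * Real.pi * Complex.I)) = 1 :=
    Complex.exp_int_mul_two_pi_mul_I _
  rw [planeWaveFun, planeWaveFun, inner_ξ_add_diracPoint_x₀ ha, inner_ξ_add_diracPoint_x₀ ha,
    rotationPhase, ← Complex.exp_add, ← mul_one (Complex.exp (_ + _)), ← h, ← Complex.exp_add]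
  congr 1
  simp only [diracRotation, Equiv.coe_fn_mk]
  push_cast
  ring

/-- Plane waves at `x` acquire the fixed nontrivial phase `c` under the rotation of the dual
lattice. -/
def HasRotationPhase (a : ℝ) (x : Plane) (c : ℂ) : Prop :=
  c ≠ 1 ∧ ∀ m, planeWaveFun a (diracPoint a) (diracRotation m) x = c * planeWaveFun a (diracPoint
    a) m x

theorem hasRotationPhase_x₀ (ha : 0 < a) : HasRotationPhase a (x₀ a) rotationPhase :=
  ⟨rotationPhase_ne_one, planeWaveFun_diracRotation ha⟩

theorem HasRotationPhase.neg {x : Plane} {c : ℂ} (h : HasRotationPhase a x c) :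
    HasRotationPhase a (-x) (conj c) := by
  refine ⟨fun h1 => h.1 ?_, fun m => ?_⟩
  · rw [← Complex.conj_conj c, h1, map_one]
  · rw [planeWaveFun_neg, planeWaveFun_neg, h.2, map_mul]

theorem HasRotationPhase.tsum_eq_zero {x : Plane} {c : ℂ} (h : HasRotationPhase a x c)
    (z w : ℂ) : ∑' m, planeWaveFun a (diracPoint a) m x *
      (res a (diracPoint a) z m * res a (diracPoint a) w m) = 0 := by
  have h1 := diracRotation.tsum_eq fun m => planeWaveFun a (diracPoint a) m x *
    (res a (diracPoint a) z m * res a (diracPoint a) w m)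
  simp only [h.2, res_diracRotation, mul_assoc c] at h1
  rw [tsum_mul_left] at h1
  refine (mul_eq_zero.1 (?_ : (c - 1) * _ = 0)).resolve_left (sub_ne_zero.2 h.1)
  rw [sub_mul, h1, one_mul, sub_self]

/-- The disk is rotation invariant, so the finite sum equals `c` times itself with `c ≠ 1`. The
cancellation is exact at each radius, and no convergence question arises. -/
theorem HasRotationPhase.greenTrunc_eq_zero (ha : 0 < a) {x : Plane} {c : ℂ}
    (h : HasRotationPhase a x c) (hx : x ∉ lattice a) (z : ℂ) (r : ℝ) :
    greenTrunc a (diracPoint a) z x r = 0 := by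
  rw [greenTrunc, if_neg hx, finsum_mem_eq_finite_toFinset_sum _ (finite_norm_le ha _ r)]
  set f := fun m => planeWaveFun a (diracPoint a) m x / (((‖ξ a m + diracPoint a‖ ^ 2 : ℝ) : ℂ) - z)
  have h1 : ∑ m ∈ (finite_norm_le ha (diracPoint a) r).toFinset, c * f m =
      ∑ m ∈ (finite_norm_le ha (diracPoint a) r).toFinset, f m := by
    refine Finset.sum_equiv diracRotation (fun m => ?_) fun m _ => ?_
    · simp [norm_diracRotation]
    · simp only [f, norm_diracRotation, h.2, mul_div_assoc]
  rw [← Finset.mul_sum] at h1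
  have h2 : (c - 1) * ∑ m ∈ (finite_norm_le ha (diracPoint a) r).toFinset, f m = 0 := by
    rw [sub_mul, h1, one_mul, sub_self]
  rw [(mul_eq_zero.1 h2).resolve_left (sub_ne_zero.2 h.1), mul_zero]

theorem x₀_notMem_lattice (ha : 0 < a) : x₀ a ∉ lattice a := by
  rintro ⟨m, n, h⟩
  have h1 : spanMap (v₁ a) (v₂ a) ![2 / 3, 2 / 3] = spanMap (v₁ a) (v₂ a) ![(m : ℝ), (n : ℝ)] := by
    simp only [spanMap, Matrix.cons_val_zero, Matrix.cons_val_one]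
    rw [← h, x₀, smul_add]
  have h2 := congrArg (cellCoord a) h1
  rw [cellCoord_spanMap ha, cellCoord_spanMap ha] at h2
  have h3 : (2 / 3 : ℝ) = m := congrFun h2 0
  have h4 : (3 * m : ℝ) = 2 := by rw [← h3]; norm_num
  have h5 : 3 * m = 2 := by exact_mod_cast h4
  omega

theorem neg_x₀_notMem_lattice (ha : 0 < a) : -x₀ a ∉ lattice a := by
  rintro ⟨m, n, h⟩
  refine x₀_notMem_lattice ha ⟨-m, -n, ?_⟩
  rw [← neg_neg (x₀ a), h, Int.cast_neg, Int.cast_neg, neg_smul, neg_smul, neg_add]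

theorem tendsto_greenTrunc_x₀ (ha : 0 < a) (z : ℂ) :
    Tendsto (greenTrunc a (diracPoint a) z (x₀ a)) atTop (𝓝 0) :=
  tendsto_const_nhds.congr fun r =>
    ((hasRotationPhase_x₀ ha).greenTrunc_eq_zero ha (x₀_notMem_lattice ha) z r).symm

theorem greenValue_x₀ (ha : 0 < a) (z : ℂ) : greenValue a (diracPoint a) z (x₀ a) = 0 :=
  (tendsto_greenTrunc_x₀ ha z).limUnder_eq

theorem greenValue_neg_x₀ (ha : 0 < a) (z : ℂ) : greenValue a (diracPoint a) z (-x₀ a) = 0 :=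
  Tendsto.limUnder_eq (tendsto_const_nhds.congr fun r =>
    ((hasRotationPhase_x₀ ha).neg.greenTrunc_eq_zero ha (neg_x₀_notMem_lattice ha) z r).symm)

/-! ### Decoupling for the triangular and honeycomb structures -/

/-- The scalar `α - g_z(0, K)`, whose zeros are the perturbed eigenvalues. -/
def secular (a α : ℝ) (z : ℂ) : ℂ := α - greenValue a (diracPoint a) z 0

theorem secular_sub (ha : 0 < a) (α : ℝ) {z w : ℂ} (hz : NonResonant a (diracPoint a) z)
    (hw : NonResonant a (diracPoint a) w) : secular a α w - secular a α z =
      (area a : ℂ)⁻¹ * ((z - w) * ∑' m, res a (diracPoint a) z m * res a (diracPoint a) w m) := by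
  rw [← greenValue_zero_sub ha hz hw, secular, secular]
  ring

theorem exists_secular_ne_zero (ha : 0 < a) (α : ℝ) :
    ∃ w, NonResonant a (diracPoint a) w ∧ secular a α w ≠ 0 := by
  by_contra! h
  have h1 := h Complex.I (nonResonant_of_im_ne_zero _ (by simp))
  have h2 := h (-Complex.I) (nonResonant_of_im_ne_zero _ (by simp))
  apply greenValue_I_ne ha (diracPoint a)
  rw [secular, sub_eq_zero] at h1 h2
  rw [← h1, ← h2]

theorem planeWaveFun_zero (k : Plane) (m : ℤ × ℤ) : planeWaveFun a k m 0 = 1 := by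
  simp [planeWaveFun]

theorem src_zero (k : Plane) (m : ℤ × ℤ) : src a k 0 m = 1 := by
  rw [src, neg_zero, planeWaveFun_zero]

theorem isDecoupled_triangular (ha : 0 < a) (α : ℝ) :
    IsDecoupled a (diracPoint a) ![α] ![(0 : Plane)] (secular a α) where
  gamma_eq z _ := by
    ext i j
    fin_cases i; fin_cases j
    simp [gammaMatrix, secular]
  sub_eq z w hz hw := secular_sub ha α hz hw
  orthogonal i j h := absurd (Subsingleton.elim i j) h
  independent c hc := by
    simp only [Fin.sum_univ_one, Matrix.cons_val_zero, src_zero, mul_one, tendsto_const_nhds_iff]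
      at hc
    ext i
    fin_cases i
    exact hc
  exists_ne_zero := exists_secular_ne_zero ha α

theorem isDecoupled_honeycomb (ha : 0 < a) (α : ℝ) :
    IsDecoupled a (diracPoint a) ![α, α] ![(0 : Plane), x₀ a] (secular a α) where
  gamma_eq z _ := by
    ext i j
    fin_cases i <;> fin_cases j <;>
      simp [gammaMatrix, secular, greenValue_x₀ ha, greenValue_neg_x₀ ha]
  sub_eq z w hz hw := secular_sub ha α hz hw
  orthogonal i j h z w := by
    have h1 := (hasRotationPhase_x₀ ha).tsum_eq_zero z w
    have h2 := (hasRotationPhase_x₀ ha).neg.tsum_eq_zero z w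
    fin_cases i <;> fin_cases j
    · exact absurd rfl h
    · simpa [src_zero] using h2
    · simpa [planeWaveFun_zero, planeWaveFun_neg] using h1
    · exact absurd rfl h
  independent c hc := by
    simp only [Fin.sum_univ_two, Matrix.cons_val_zero, Matrix.cons_val_one, src_zero, mul_one] at hc
    obtain ⟨h1, h2⟩ := (hasRotationPhase_x₀ ha).neg
    -- Subtracting the rotated sequence cancels `c 0` and leaves a sequence of constant norm `‖c 1‖
    -- ‖conj rotationPhase - 1‖`; its limit is zero, which forces `c 1 = 0`.
    have h3 := (hc.sub (hc.comp diracRotation.injective.tendsto_cofinite)).norm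
    have h4 : ∀ m, ‖c 0 + c 1 * src a (diracPoint a) (x₀ a) m -
        (c 0 + c 1 * src a (diracPoint a) (x₀ a) (diracRotation m))‖ =
          ‖c 1‖ * ‖conj rotationPhase - 1‖ := by
      intro m
      rw [add_sub_add_left_eq_sub, ← mul_sub, norm_mul, norm_sub_rev (conj rotationPhase)]
      congr 1
      rw [src, src, h2, ← one_sub_mul, norm_mul]
      exact (congrArg _ (norm_src (diracPoint a) (x₀ a) m)).trans (mul_one _)
    simp only [Function.comp_def, h4, sub_zero, norm_zero, tendsto_const_nhds_iff] at h3
    have h5 : c 1 = 0 :=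
      norm_eq_zero.1 ((mul_eq_zero.1 h3).resolve_right (norm_ne_zero_iff.2 (sub_ne_zero.2 h1)))
    simp only [h5, zero_mul, add_zero, tendsto_const_nhds_iff] at hc
    ext i
    fin_cases i
    exacts [hc, h5]
  exists_ne_zero := exists_secular_ne_zero ha α

end PointScatterer

end

open PointScatterer
theorem mainTheorem6 (a : ℝ) (ha : 0 < a) (α : ℝ) :
    (opSpectrum (honeycomb a α (diracPoint a)) \ opSpectrum (freeLaplacian a (diracPoint a)) =
      opSpectrum (triangular a α (diracPoint a)) \ opSpectrum (freeLaplacian a (diracPoint a))) ∧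
    (∀ z ∈ opSpectrum (honeycomb a α (diracPoint a)) \
        opSpectrum (freeLaplacian a (diracPoint a)),
      mult z (honeycomb a α (diracPoint a)) = 2) ∧
    (∀ z : ℂ, z ∉ opSpectrum (freeLaplacian a (diracPoint a)) →
      Tendsto (greenTrunc a (diracPoint a) z (x₀ a)) atTop (𝓝 0) ∧
      greenValue a (diracPoint a) z (x₀ a) = 0) := by
  have H := isDecoupled_honeycomb ha α
  have T := isDecoupled_triangular ha α
  refine ⟨?_, ?_, fun z _ => ⟨tendsto_greenTrunc_x₀ ha z, greenValue_x₀ ha z⟩⟩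
  · ext z
    refine and_congr_left fun hz => ?_
    have hz' := (notMem_opSpectrum_freeLaplacian_iff ha _ z).1 hz
    exact (H.mem_opSpectrum_iff ha hz').trans (T.mem_opSpectrum_iff ha hz').symm
  · rintro z ⟨h1, h2⟩
    have hz' := (notMem_opSpectrum_freeLaplacian_iff ha _ z).1 h2
    exact H.mult_eq ha hz' ((H.mem_opSpectrum_iff ha hz').1 h1)
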